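/- Setting. For $k\ge 2$, a $k$-armed bandit environment $\mathcal D=(\mathcal D_1,\dots,\mathcal D_k)$ consists of probability distributions on $\mathbb R$ with means $\mu_1,\dots,\mu_k$ such that each $\mathcal D_i$ is $1$-sub-Gaussian around its mean (that is, $\mathbb E\,e^{s(X-\mu_i)}\le e^{s^2/2}$ for all $s\in\mathbb R$ if $X\sim\mathcal D_i$) and $|\mu_i-\mu_j|\le 1$ for all $i,j$. In each round $t=1,2,\dots$ a (possibly randomized, non-anticipating) policy chooses an action $\pi_t\in\{1,\dots,k\}$ according to a probability kernel depending on the past actions and observed rewards, and then observes a reward drawn from $\mathcal D_{\pi_t}$ independently of the past given $\pi_t$. A policy may depend on the horizon $T$ (and on $k$); $\mathbb P^\pi_{\mathcal D}$ and $\mathbb E^\pi_{\mathcal D}$ denote the induced law and expectation over $T$ rounds. The regret is $R^\pi(T)=\sup_{\mathcal D}\{T\max_i\mu_i-\mathbb E^\pi_{\mathcal D}[\sum_{t=1}^T\mu_{\pi_t}]\}$. A policy achieves $\tilde O(T^a)$ regret if there are constants $C$ and $p\in\mathbb N$ with $R^\pi(T)\le C(\log T)^pT^a$ for all sufficiently large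 $T$. The number of re-switches of action $i$ is the number of rounds $t\le T$ with $\pi_t=i$ and either $t=1$ or $\pi_{t-1}\ne i$. For a function $n(T)$, say that a policy needs $n(T)$ re-switches of each action if for all sufficiently large $T$ and every action $i$ there is an environment $\mathcal D$ in which $i$ is the unique worst action (that is, $\mu_i<\mu_j$ for all $j\ne i$) and in which, with positive probability under $\mathbb P^\pi_{\mathcal D}$, every action, including the worst one, is re-switched at least $n(T)$ times. Proposition. (1) For every $k\ge2$ and every integer $N\ge1$, every policy that achieves $\tilde O\big(T^{1/(2-2^{-N})}\big)$ regret needs $\lceil N/2\rceil$ re-switches of each action. (2) $\Theta(\log\log T)$ re-switches of each action are necessary and sufficient for $\tilde O(\sqrt T)$ regret: there are absolute constants $c_1,c_2>0$ such that for every $k\ge2$, (a) every policy that achieves $\tilde O(\sqrt T)$ regret needs $c_1\log\log T$ re-switches of each action; and (b) there is a policy that achieves $\tilde O(\sqrt T)$ regret and for which, for all sufficiently large $T$ and every environment $\mathcal D$, almost surely no action is re-switched more than $c_2\log\log T$ times. -/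

import Mathlib

open MeasureTheory ProbabilityTheory Filter

namespace Bandit

/-- The interaction record of `t` rounds of a `k`-armed bandit: for each round, the action chosen
and the reward observed. -/
abbrev Hist (k t : ℕ) : Type := Fin t → Fin k × ℝ

/-- An environment: reward distributions of the `k` actions. Each is a probability measure on `ℝ`
that is sub-Gaussian with variance proxy `1` around its mean, and any two means differ by at
most `1`. -/
structure Env (k : ℕ) where
  /-- the reward distribution of each action -/
  dist : Fin k → Measure ℝ
  isProb : ∀ i, IsProbabilityMeasure (dist i)
  subGaussian : ∀ i, HasSubgaussianMGF (fun x => x - ∫ y, y ∂(dist i)) 1 (dist i)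
  gap_le_one : ∀ i j, |(∫ y, y ∂(dist i)) - ∫ y, y ∂(dist j)| ≤ 1

/-- The mean reward of action `i`. -/
noncomputable def Env.mean {k : ℕ} (D : Env k) (i : Fin k) : ℝ := ∫ y, y ∂(D.dist i)

/-- The mean reward of an optimal action. -/
noncomputable def Env.best {k : ℕ} (D : Env k) : ℝ := ⨆ i, D.mean i

/-- The reward distributions as a kernel from actions to rewards. -/
noncomputable def Env.reward {k : ℕ} (D : Env k) : Kernel (Fin k) ℝ :=
  Kernel.ofFunOfCountable D.dist

instance {k : ℕ} (D : Env k) : IsMarkovKernel D.reward := ⟨D.isProb⟩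

/-- A non-anticipating, possibly randomized policy: after `t` rounds, a Markov kernel from the
past actions and observations to the next action. -/
structure Policy (k : ℕ) where
  /-- the conditional law of the next action given the history -/
  act : (t : ℕ) → Kernel (Hist k t) (Fin k)
  isMarkov : ∀ t, IsMarkovKernel (act t)

instance {k : ℕ} (ρ : Policy k) (t : ℕ) : IsMarkovKernel (ρ.act t) := ρ.isMarkov t

/-- The conditional law of the next action and reward given the history. The reward depends on
the past only through the action chosen. -/
noncomputable def step {k : ℕ} (ρ : Policy k) (D : Env k) (t : ℕ) :
    Kernel (Hist k t) (Fin k × ℝ) :=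
  (ρ.act t) ⊗ₖ (Kernel.prodMkLeft (Hist k t) D.reward)

instance {k : ℕ} (ρ : Policy k) (D : Env k) (t : ℕ) : IsMarkovKernel (step ρ D t) := by
  unfold step; infer_instance

/-- The law of the first `t` rounds when policy `ρ` is run in environment `D`. -/
noncomputable def law {k : ℕ} (ρ : Policy k) (D : Env k) : (t : ℕ) → Measure (Hist k t)
  | 0 => Measure.dirac Fin.elim0
  | t + 1 => ((law ρ D t) ⊗ₘ (step ρ D t)).map
      (fun p => (Fin.snoc p.1 p.2 : Hist k (t + 1)))

theorem measurable_snoc {k t : ℕ} :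
    Measurable (fun p : Hist k t × (Fin k × ℝ) => (Fin.snoc p.1 p.2 : Hist k (t + 1))) := by
  refine measurable_pi_lambda _ fun s => ?_
  refine Fin.lastCases ?_ (fun s => ?_) s
  · simpa using measurable_snd
  · simpa [Function.comp_def] using (measurable_pi_apply s).comp measurable_fst

instance {k : ℕ} (ρ : Policy k) (D : Env k) (t : ℕ) : IsProbabilityMeasure (law ρ D t) := by
  induction t with
  | zero => unfold law; infer_instance
  | succ t ih =>
    unfold law
    exact Measure.isProbabilityMeasure_map measurable_snoc.aemeasurable

/-- The expected shortfall over `T` rounds of policy `ρ` in environment `D`, compared with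
always choosing an optimal action. -/
noncomputable def regretIn {k : ℕ} (ρ : Policy k) (D : Env k) (T : ℕ) : ℝ :=
  T * D.best - ∫ h, ∑ t, D.mean (h t).1 ∂(law ρ D T)

/-- The (distribution-free) regret of policy `ρ` over `T` rounds: the supremum over all
environments. -/
noncomputable def regret {k : ℕ} (ρ : Policy k) (T : ℕ) : EReal :=
  ⨆ D : Env k, (regretIn ρ D T : EReal)

/-- A policy may use the horizon as an input, so it is a family `π`, with `π T` the policy that is
run when the horizon is `T`. It achieves `Õ(T ^ a)` regret if its regret is at most `T ^ a` up to
a constant factor and a power of `log T`, for all large `T`. -/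
def AchievesRegret {k : ℕ} (π : ℕ → Policy k) (a : ℝ) : Prop :=
  ∃ (C : ℝ) (p : ℕ), ∀ᶠ T : ℕ in atTop,
    regret (π T) T ≤ ((C * Real.log T ^ p * (T : ℝ) ^ a : ℝ) : EReal)

/-- The number of re-switches of action `i`: the number of rounds in which `i` is chosen and was
not chosen in the preceding round, where the first round has no preceding round. -/
def reswitches {k T : ℕ} (h : Hist k T) (i : Fin k) : ℕ :=
  (Finset.univ.filter fun t : Fin T =>
    (h t).1 = i ∧ ∀ s : Fin T, (s : ℕ) + 1 = t → (h s).1 ≠ i).card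

/-- The policy `π` cannot avoid `n T` re-switches of every action: for all large horizons `T`, and
whichever action `i` is to be the worst one, there is an environment with unique worst action `i`
in which, with positive probability, every action (the worst one included) is re-switched
at least `n T` times. -/
def Needs {k : ℕ} (π : ℕ → Policy k) (n : ℕ → ℝ) : Prop :=
  ∀ᶠ T : ℕ in atTop, ∀ i : Fin k, ∃ D : Env k, (∀ j, j ≠ i → D.mean i < D.mean j) ∧
    0 < law (π T) D T {h | ∀ j, n T ≤ (reswitches h j : ℝ)}

/-- The policy `π` gets by with `n T` re-switches of each action: for all large horizons `T`, in
every environment, almost surely no action is re-switched more than `n T` times. -/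
def Within {k : ℕ} (π : ℕ → Policy k) (n : ℕ → ℝ) : Prop :=
  ∀ᶠ T : ℕ in atTop, ∀ D : Env k, ∀ᵐ h ∂(law (π T) D T), ∀ j, (reswitches h j : ℝ) ≤ n T

end Bandit

namespace Bandit

/-! Necessity. Run the policy with all rewards standard Gaussian and cut the rounds by a grid `τ`
into 2n-1 intervals. If every action is chosen in each even interval and avoided at some round of
each odd one, then every action is re-switched n times (`le_reswitches`). So if this many
re-switches of all actions have probability zero, a union bound yields an interval r and an action j
such that, with probability at least 1/(k(2n-1)), no action of B is chosen during interval r, where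
B is {j} for even r and its complement for odd r. Raise the means on B by δ, about τ_r^(-1/2). On
this event the change shows only in rewards seen before τ_r, so a chi-squared change of measure
(`law_lintegral_sq_le`) loses a factor exp(δ²τ_r) ≤ e, and the policy pays δ(τ_{r+1} - τ_r) on an
event that is still likely. The grid that balances all intervals gives regret of order T^(1/(2 -
2^(-(2n-2)))) up to the factor (k(2n-1))^(-2) (`regret_ge_rpow`). For n = ⌈N/2⌉, and for n about
(log log T)/4, this exceeds the assumed bound. Hence n re-switches of every action have positive
probability, and by absolute continuity also in a Gaussian environment with a prescribed worst
action.

Sufficiency. Eliminate actions in batches. A batch has k slots of equal length; slot i plays i if i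
is active and otherwise a substitute monotone in i. Within a batch the actions played are thus
nondecreasing, so each action is re-switched at most once per batch (`reswitches_le`). Slots are
fixed sets of rounds, which makes the concentration bound elementary (`noise_tail`). With slots of
length T^(1 - 2^(-(m+1))), about log log T batches cover the horizon and each costs √T up to
logarithms. -/

/-! ### One-round disintegration of the law, and regret as a sum of gaps. -/

theorem lintegral_law_succ {k : ℕ} (ρ : Policy k) (D : Env k) (t : ℕ)
    {f : Hist k (t + 1) → ENNReal} (hf : Measurable f) :
    ∫⁻ h, f h ∂(law ρ D (t + 1)) =
      ∫⁻ h, ∫⁻ a, ∫⁻ x, f (Fin.snoc h (a, x) : Hist k (t + 1)) ∂(D.dist a) ∂(ρ.act t h)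
        ∂(law ρ D t) := by
  have hm : Measurable fun p : Hist k t × (Fin k × ℝ) =>
      f (Fin.snoc p.1 p.2 : Hist k (t + 1)) := hf.comp measurable_snoc
  rw [law, lintegral_map hf measurable_snoc, Measure.lintegral_compProd hm]
  refine lintegral_congr fun h => ?_
  have hm' : Measurable fun p : Fin k × ℝ => f (Fin.snoc h p : Hist k (t + 1)) :=
    hm.comp measurable_prodMk_left
  exact Kernel.lintegral_compProd _ _ _ hm'

theorem measurable_lintegral_snoc {k : ℕ} (ρ : Policy k) (D : Env k) (t : ℕ)
    {f : Hist k (t + 1) → ENNReal} (hf : Measurable f) :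
    Measurable fun h : Hist k t =>
      ∫⁻ a, ∫⁻ x, f (Fin.snoc h (a, x) : Hist k (t + 1)) ∂(D.dist a) ∂(ρ.act t h) := by
  have hm : Measurable fun p : Hist k t × (Fin k × ℝ) =>
      f (Fin.snoc p.1 p.2 : Hist k (t + 1)) := hf.comp measurable_snoc
  have h1 : Measurable fun h : Hist k t =>
      ∫⁻ p, f (Fin.snoc h p : Hist k (t + 1)) ∂(step ρ D t h) :=
    Measurable.lintegral_kernel_prod_right' hm
  convert h1 using 2 with h
  have hm' : Measurable fun p : Fin k × ℝ => f (Fin.snoc h p : Hist k (t + 1)) :=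
    hm.comp measurable_prodMk_left
  exact (Kernel.lintegral_compProd (ρ.act t) (Kernel.prodMkLeft (Hist k t) D.reward) h hm').symm

theorem measurable_snoc_right {k t : ℕ} (h : Hist k t) (a : Fin k) :
    Measurable fun x : ℝ => (Fin.snoc h (a, x) : Hist k (t + 1)) :=
  measurable_snoc.comp (measurable_const.prodMk (measurable_const.prodMk measurable_id))

theorem measurable_castLE {k t T : ℕ} (hT : t ≤ T) :
    Measurable fun h : Hist k T => (fun s => h (Fin.castLE hT s) : Hist k t) :=
  measurable_pi_lambda _ fun _ => measurable_pi_apply _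

/-- The law of the first `t` rounds is a marginal of the law of the first `T` rounds. -/
theorem lintegral_law_castLE {k : ℕ} (ρ : Policy k) (D : Env k) {t T : ℕ} (hT : t ≤ T)
    {f : Hist k t → ENNReal} (hf : Measurable f) :
    ∫⁻ h, f (fun s => h (Fin.castLE hT s)) ∂(law ρ D T) = ∫⁻ h, f h ∂(law ρ D t) := by
  induction T, hT using Nat.le_induction with
  | base => rfl
  | succ T hT ih =>
    have hm : Measurable fun h : Hist k (T + 1) =>
        f (fun s => h (Fin.castLE (Nat.le_succ_of_le hT) s)) := hf.comp (measurable_castLE _)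
    rw [lintegral_law_succ ρ D T hm, ← ih]
    refine lintegral_congr fun h => ?_
    have key : ∀ p : Fin k × ℝ, (fun s : Fin t => (Fin.snoc h p : Hist k (T + 1))
        (Fin.castLE (Nat.le_succ_of_le hT) s)) = fun s => h (Fin.castLE hT s) := by
      intro p
      funext s
      exact Fin.snoc_castSucc (α := fun _ => Fin k × ℝ) p h (Fin.castLE hT s)
    have hprob := D.isProb
    simp [key]

theorem Env.mean_le_best {k : ℕ} (D : Env k) (i : Fin k) : D.mean i ≤ D.best :=
  le_ciSup (Set.finite_range _).bddAbove i

theorem Env.best_sub_mean_le_one {k : ℕ} (D : Env k) (i : Fin k) : D.best - D.mean i ≤ 1 := by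
  have : Nonempty (Fin k) := ⟨i⟩
  rw [sub_le_iff_le_add]
  refine ciSup_le fun j => ?_
  have := (abs_le.1 (D.gap_le_one j i)).2
  simp only [Env.mean]
  linarith

theorem measurable_action {k T : ℕ} (t : Fin T) : Measurable fun h : Hist k T => (h t).1 :=
  measurable_fst.comp (measurable_pi_apply t)

theorem integrable_action {k T : ℕ} (ρ : Policy k) (D : Env k) (g : Fin k → ℝ) (t : Fin T) :
    Integrable (fun h : Hist k T => g (h t).1) (law ρ D T) := by
  obtain ⟨C, hC⟩ := (Set.finite_range fun i => ‖g i‖).bddAbove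
  exact Integrable.of_bound
    ((measurable_of_finite g).comp (measurable_action t)).aestronglyMeasurable C
    (Eventually.of_forall fun h => hC ⟨_, rfl⟩)

/-- The regret is the expected sum of the gaps of the chosen actions. -/
theorem regretIn_eq {k : ℕ} (ρ : Policy k) (D : Env k) (T : ℕ) :
    regretIn ρ D T = ∫ h, ∑ t, (D.best - D.mean (h t).1) ∂(law ρ D T) := by
  simp only [Finset.sum_sub_distrib]
  rw [integral_sub (integrable_const _)
    (integrable_finsetSum _ fun t _ => integrable_action ρ D D.mean t)]
  simp [regretIn]

theorem regretIn_le_regret {k : ℕ} (ρ : Policy k) (D : Env k) (T : ℕ) :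
    (regretIn ρ D T : EReal) ≤ regret ρ T :=
  le_iSup (fun D : Env k => (regretIn ρ D T : EReal)) D

/-! ### Chi-squared change of environment. -/

theorem lintegral_mul_sq_le {α : Type*} [MeasurableSpace α] (μ : Measure α) {f g : α → ENNReal}
    (hf : Measurable f) (hg : Measurable g) :
    (∫⁻ x, f x * g x ∂μ) ^ 2 ≤ (∫⁻ x, f x ^ 2 ∂μ) * ∫⁻ x, g x ^ 2 ∂μ := by
  have h := ENNReal.lintegral_mul_le_Lp_mul_Lq μ Real.HolderConjugate.two_two
    hf.aemeasurable hg.aemeasurable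
  simp only [Pi.mul_apply, ENNReal.rpow_two] at h
  refine (pow_le_pow_left' h 2).trans_eq ?_
  have key : ∀ y : ENNReal, (y ^ ((1 : ℝ) / 2)) ^ 2 = y := fun y => by
    rw [← ENNReal.rpow_two, ← ENNReal.rpow_mul]; norm_num
  rw [mul_pow, key, key]

theorem lintegral_sq_le {α : Type*} [MeasurableSpace α] (μ : Measure α) [IsProbabilityMeasure μ]
    {f : α → ENNReal} (hf : Measurable f) :
    (∫⁻ x, f x ∂μ) ^ 2 ≤ ∫⁻ x, f x ^ 2 ∂μ := by
  simpa using lintegral_mul_sq_le μ hf (measurable_const (a := 1))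

/-- Completing the square: the chi-squared integrand is a multiple of a Gaussian density, so it
integrates to exp((m - m')²). -/
theorem gaussianPDFReal_sq_div (m m' x : ℝ) :
    gaussianPDFReal m 1 x ^ 2 / gaussianPDFReal m' 1 x =
      Real.exp ((m - m') ^ 2) * gaussianPDFReal (2 * m - m') 1 x := by
  simp only [gaussianPDFReal, NNReal.coe_one, mul_one]
  have hc : (√(2 * Real.pi))⁻¹ ≠ 0 := by positivity
  rw [div_eq_iff (by positivity), mul_pow, ← Real.exp_nat_mul]
  rw [show Real.exp ((m - m') ^ 2) * ((√(2 * Real.pi))⁻¹ *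
      Real.exp (-(x - (2 * m - m')) ^ 2 / 2)) * ((√(2 * Real.pi))⁻¹ *
      Real.exp (-(x - m') ^ 2 / 2)) = (√(2 * Real.pi))⁻¹ ^ 2 * (Real.exp ((m - m') ^ 2) *
      Real.exp (-(x - (2 * m - m')) ^ 2 / 2) * Real.exp (-(x - m') ^ 2 / 2)) by ring,
    ← Real.exp_add, ← Real.exp_add]
  congr 2
  push_cast
  ring

/-- The chi-squared form of the change of mean for Gaussian measures. -/
theorem gaussian_lintegral_sq_le (m m' : ℝ) {f : ℝ → ENNReal} (hf : Measurable f) :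
    (∫⁻ x, f x ∂(gaussianReal m 1)) ^ 2 ≤
      ENNReal.ofReal (Real.exp ((m - m') ^ 2)) * ∫⁻ x, f x ^ 2 ∂(gaussianReal m' 1) := by
  have h1 : (1 : NNReal) ≠ 0 := one_ne_zero
  rw [gaussianReal_of_var_ne_zero m h1, gaussianReal_of_var_ne_zero m' h1,
    lintegral_withDensity_eq_lintegral_mul _ (measurable_gaussianPDF m 1) hf,
    lintegral_withDensity_eq_lintegral_mul _ (measurable_gaussianPDF m' 1) (hf.pow_const 2)]
  set φ := gaussianPDFReal m 1
  set ψ := gaussianPDFReal m' 1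
  have hφ : ∀ x, 0 < φ x := fun x => gaussianPDFReal_pos m 1 x h1
  have hψ : ∀ x, 0 < ψ x := fun x => gaussianPDFReal_pos m' 1 x h1
  have mφ : Measurable φ := measurable_gaussianPDFReal m 1
  have mψ : Measurable ψ := measurable_gaussianPDFReal m' 1
  -- Cauchy–Schwarz will be applied to φ f = (√ψ f)(φ/√ψ).
  have e1 : ∀ x, (gaussianPDF m 1 * f) x =
      (ENNReal.ofReal √(ψ x) * f x) * ENNReal.ofReal (φ x / √(ψ x)) := by
    intro x
    rw [mul_right_comm, ← ENNReal.ofReal_mul (Real.sqrt_nonneg _),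
      mul_div_cancel₀ _ (Real.sqrt_pos.2 (hψ x)).ne']
    rfl
  have e2 : ∀ x, (ENNReal.ofReal √(ψ x) * f x) ^ 2 = (gaussianPDF m' 1 * fun x => f x ^ 2) x := by
    intro x
    rw [mul_pow, ← ENNReal.ofReal_pow (Real.sqrt_nonneg _), Real.sq_sqrt (hψ x).le]
    rfl
  have e3 : ∀ x, ENNReal.ofReal (φ x / √(ψ x)) ^ 2 =
      ENNReal.ofReal (Real.exp ((m - m') ^ 2)) * gaussianPDF (2 * m - m') 1 x := by
    intro x
    rw [← ENNReal.ofReal_pow (div_nonneg (hφ x).le (Real.sqrt_nonneg _)), div_pow,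
      Real.sq_sqrt (hψ x).le, gaussianPDFReal_sq_div, ENNReal.ofReal_mul (Real.exp_pos _).le]
    rfl
  rw [lintegral_congr e1]
  have h := lintegral_mul_sq_le volume (f := fun x => ENNReal.ofReal √(ψ x) * f x)
    (g := fun x => ENNReal.ofReal (φ x / √(ψ x))) (mψ.sqrt.ennreal_ofReal.mul hf)
    (mφ.div mψ.sqrt).ennreal_ofReal
  rwa [lintegral_congr e2, lintegral_congr e3, lintegral_const_mul _ (measurable_gaussianPDF _ _),
    lintegral_gaussianPDF_eq_one _ h1, mul_one, mul_comm (lintegral _ _)] at h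

/-- The environment with unit-variance Gaussian rewards of given means. -/
noncomputable def gaussianEnv {k : ℕ} (m : Fin k → ℝ) (hm : ∀ i j, |m i - m j| ≤ 1) : Env k where
  dist i := gaussianReal (m i) 1
  isProb i := inferInstance
  subGaussian i := by
    rw [integral_id_gaussianReal]
    have hmap : (gaussianReal (m i) 1).map (fun x => x - m i) = gaussianReal 0 1 := by
      rw [gaussianReal_map_sub_const, sub_self]
    have hmeas : Measurable fun x : ℝ => x - m i := measurable_id.sub_const _
    refine ⟨fun t => ?_, fun t => ?_⟩
    · have := integrable_exp_mul_gaussianReal (μ := 0) (v := 1) t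
      rw [← hmap] at this
      exact (integrable_map_measure (by fun_prop) hmeas.aemeasurable).1 this
    · rw [mgf_gaussianReal hmap]
      simp
  gap_le_one i j := by simpa [integral_id_gaussianReal] using hm i j

theorem gaussianEnv_mean {k : ℕ} (m : Fin k → ℝ) (hm : ∀ i j, |m i - m j| ≤ 1) (i : Fin k) :
    (gaussianEnv m hm).mean i = m i := integral_id_gaussianReal

/-- Change of environment: comparison of the laws of a policy in two environments that differ only
on the actions in `B`, for functions supported where actions in `B` are chosen only in the first
`n` rounds. -/
theorem law_lintegral_sq_le {k : ℕ} (ρ : Policy k) (D D' : Env k) (B : Set (Fin k))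
    (c : ENNReal)
    (hB : ∀ a, a ∉ B → D.dist a = D'.dist a)
    (hD : ∀ a (f : ℝ → ENNReal), Measurable f →
      (∫⁻ x, f x ∂(D.dist a)) ^ 2 ≤ c * ∫⁻ x, f x ^ 2 ∂(D'.dist a))
    (n t : ℕ) (f : Hist k t → ENNReal) (hf : Measurable f)
    (hsupp : ∀ h, f h ≠ 0 → ∀ s : Fin t, n ≤ s → (h s).1 ∉ B) :
    (∫⁻ h, f h ∂(law ρ D t)) ^ 2 ≤ c ^ (min t n) * ∫⁻ h, f h ^ 2 ∂(law ρ D' t) := by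
  have hprob := D.isProb
  have hprob' := D'.isProb
  induction t with
  | zero =>
    simp only [law, Nat.zero_min, pow_zero, one_mul]
    exact lintegral_sq_le _ hf
  | succ t ih =>
    rw [lintegral_law_succ ρ D t hf, lintegral_law_succ ρ D' t (hf.pow_const 2)]
    -- The price of round t. From round n on it is 1: `f` vanishes if an action of `B` is chosen,
    -- and the other actions have equal reward laws. The policy kernel is common to both
    -- environments and costs nothing by Jensen.
    set d : ENNReal := if t < n then c else 1 with hd
    have hstep : ∀ h a, (∫⁻ x, f (Fin.snoc h (a, x) : Hist k (t + 1)) ∂(D.dist a)) ^ 2 ≤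
        d * ∫⁻ x, f (Fin.snoc h (a, x) : Hist k (t + 1)) ^ 2 ∂(D'.dist a) := by
      intro h a
      have hm : Measurable fun x => f (Fin.snoc h (a, x) : Hist k (t + 1)) :=
        hf.comp (measurable_snoc_right h a)
      by_cases htn : t < n
      · rw [hd, if_pos htn]
        exact hD a _ hm
      · rw [hd, if_neg htn, one_mul]
        by_cases ha : a ∈ B
        · have h0 : ∀ x, f (Fin.snoc h (a, x) : Hist k (t + 1)) = 0 := by
            intro x
            by_contra hne
            refine hsupp _ hne (Fin.last t) (by simpa using htn) ?_
            simpa using ha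
          simp [h0]
        · rw [hB a ha]
          exact lintegral_sq_le _ hm
    have hg := measurable_lintegral_snoc ρ D t hf
    refine (ih _ hg ?_).trans ?_
    · intro h hne s hs
      have : ∃ a x, f (Fin.snoc h (a, x) : Hist k (t + 1)) ≠ 0 := by
        by_contra! h0
        exact hne (by simp [h0])
      obtain ⟨a, x, hax⟩ := this
      have := hsupp _ hax s.castSucc (by simpa using hs)
      simpa using this
    · have hpow : c ^ min (t + 1) n = c ^ min t n * d := by
        by_cases htn : t < n
        · rw [hd, if_pos htn, min_eq_left htn.le, min_eq_left (Nat.succ_le_of_lt htn), pow_succ]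
        · rw [hd, if_neg htn, mul_one, min_eq_right (by omega), min_eq_right (by omega)]
      rw [hpow, mul_assoc, ← lintegral_const_mul d
        (measurable_lintegral_snoc ρ D' t (hf.pow_const 2))]
      gcongr with h
      refine (lintegral_sq_le _ (measurable_of_finite _)).trans ?_
      rw [← lintegral_const_mul d (measurable_of_finite _)]
      exact lintegral_mono (hstep h)

theorem measurableSet_actions {k T : ℕ} (P : (Fin T → Fin k) → Prop) :
    MeasurableSet {h : Hist k T | P fun s => (h s).1} := by
  have h1 : Measurable fun h : Hist k T => fun s => (h s).1 :=
    measurable_pi_lambda _ fun s => measurable_action s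
  exact h1 (Set.toFinite {a | P a}).measurableSet

theorem gaussianEnv_comparison {k : ℕ} {m m' : Fin k → ℝ} (hm : ∀ i j, |m i - m j| ≤ 1)
    (hm' : ∀ i j, |m' i - m' j| ≤ 1) {δ : ℝ} (hδ : ∀ a, (m a - m' a) ^ 2 ≤ δ ^ 2)
    (a : Fin k) {f : ℝ → ENNReal} (hf : Measurable f) :
    (∫⁻ x, f x ∂((gaussianEnv m hm).dist a)) ^ 2 ≤
      ENNReal.ofReal (Real.exp (δ ^ 2)) * ∫⁻ x, f x ^ 2 ∂((gaussianEnv m' hm').dist a) := by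
  refine (gaussian_lintegral_sq_le (m a) (m' a) hf).trans ?_
  exact mul_le_mul_left (ENNReal.ofReal_le_ofReal (Real.exp_le_exp.2 (hδ a))) _

theorem gaussianEnv_law_sq_le {k : ℕ} (ρ : Policy k) {m m' : Fin k → ℝ}
    (hm : ∀ i j, |m i - m j| ≤ 1) (hm' : ∀ i j, |m' i - m' j| ≤ 1) {δ : ℝ}
    (hδ : ∀ a, (m a - m' a) ^ 2 ≤ δ ^ 2) (B : Set (Fin k)) (hB : ∀ a, a ∉ B → m a = m' a)
    (n t : ℕ) {E : Set (Hist k t)} (hE : MeasurableSet E)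
    (hEB : ∀ h ∈ E, ∀ s : Fin t, n ≤ s → (h s).1 ∉ B) :
    (law ρ (gaussianEnv m hm) t E) ^ 2 ≤
      ENNReal.ofReal (Real.exp (δ ^ 2)) ^ (min t n) * law ρ (gaussianEnv m' hm') t E := by
  have h := law_lintegral_sq_le ρ (gaussianEnv m hm) (gaussianEnv m' hm') B _
    (fun a ha => by simp [gaussianEnv, hB a ha])
    (fun a f hf => gaussianEnv_comparison hm hm' hδ a hf) n t (E.indicator 1)
    (measurable_one.indicator hE) (fun h hh s hs => hEB h (by
      by_contra hne
      exact hh (Set.indicator_of_notMem hne _)) s hs)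
  have e : ∀ h, E.indicator (1 : Hist k t → ENNReal) h ^ 2 = E.indicator 1 h := fun h => by
    by_cases hh : h ∈ E <;> simp [hh]
  simpa only [e, lintegral_indicator_one hE] using h

/-- A null event in one Gaussian environment is a null event in every other one. -/
theorem gaussianEnv_law_null {k : ℕ} (ρ : Policy k) {m m' : Fin k → ℝ}
    (hm : ∀ i j, |m i - m j| ≤ 1) (hm' : ∀ i j, |m' i - m' j| ≤ 1) {T : ℕ}
    {E : Set (Hist k T)} (hE : MeasurableSet E)
    (h0 : law ρ (gaussianEnv m' hm') T E = 0) : law ρ (gaussianEnv m hm) T E = 0 := by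
  obtain ⟨C, hC⟩ := (Set.finite_range fun a => (m a - m' a) ^ 2).bddAbove
  -- With every action in `B` and all `T` rounds paid for, the support condition is vacuous.
  have h := gaussianEnv_law_sq_le ρ hm hm' (δ := √(max C 0)) (fun a => by
    rw [Real.sq_sqrt (le_max_right _ _)]
    exact (hC ⟨a, rfl⟩).trans (le_max_left _ _)) Set.univ (by simp) T T hE
    (fun h _ s hs => absurd s.2 (by omega))
  rw [h0, mul_zero] at h
  simpa using h

/-! ### Counting re-switches along a grid of rounds. -/

/-- Take the least round from `l` on that chooses `j`; `hl` covers the case that this round is `l`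
itself. -/
theorem exists_first_choice {k T : ℕ} (h : Hist k T) (j : Fin k) {l : ℕ} {s : Fin T}
    (hl : ∀ q : Fin T, (q : ℕ) + 1 = l → (h q).1 ≠ j) (hs : l ≤ s) (hj : (h s).1 = j) :
    ∃ u : Fin T, l ≤ u ∧ u ≤ s ∧ (h u).1 = j ∧ ∀ q : Fin T, (q : ℕ) + 1 = u → (h q).1 ≠ j := by
  obtain ⟨u, ⟨hu1, hu2, hu3⟩, hmin⟩ := wellFounded_lt.has_min
    {u : Fin T | l ≤ u ∧ u ≤ s ∧ (h u).1 = j} ⟨s, hs, le_rfl, hj⟩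
  refine ⟨u, hu1, hu2, hu3, fun q hq hqj => ?_⟩
  by_cases hlq : l ≤ q
  · have hqu : q < u := by rw [Fin.lt_def]; omega
    exact hmin q ⟨hlq, hqu.le.trans hu2, hqj⟩ hqu
  · exact hl q (by omega) hqj

/-- If an action is chosen in the even-numbered and avoided somewhere in the odd-numbered of `2n-1`
consecutive intervals of rounds, it is re-switched at least `n` times. -/
theorem le_reswitches {k T : ℕ} (h : Hist k T) (j : Fin k) {n : ℕ} {τ : ℕ → ℕ} (hτ : Monotone τ)
    (heven : ∀ q < n, ∃ s : Fin T, τ (2 * q) ≤ s ∧ s < τ (2 * q + 1) ∧ (h s).1 = j)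
    (hodd : ∀ q, q + 1 < n → ∃ s : Fin T, τ (2 * q + 1) ≤ s ∧ s < τ (2 * q + 2) ∧ (h s).1 ≠ j) :
    n ≤ reswitches h j := by
  have key : ∀ q : Fin n, ∃ u : Fin T, ((h u).1 = j ∧ ∀ s : Fin T, (s : ℕ) + 1 = u → (h s).1 ≠ j) ∧
      u < τ (2 * q + 1) ∧ ∀ p < (q : ℕ), τ (2 * p + 1) ≤ u := by
    rintro ⟨q, hq⟩
    obtain ⟨s, hs1, hs2, hs3⟩ := heven q hq
    rcases q with _ | q
    · obtain ⟨u, -, hu2, hu3⟩ := exists_first_choice h j (l := 0) (s := s)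
        (fun q hq => by omega) (Nat.zero_le _) hs3
      exact ⟨u, hu3, lt_of_le_of_lt hu2 hs2, fun p hp => absurd hp (Nat.not_lt_zero p)⟩
    -- The search starts just after an avoiding round `w` of the preceding odd interval. The round
    -- found may precede its even interval, but it comes after the previous even one, which suffices
    -- for distinctness.
    · obtain ⟨w, hw1, hw2, hw3⟩ := hodd q hq
      obtain ⟨u, hu1, hu2, hu3⟩ := exists_first_choice h j (l := w + 1) (s := s)
        (fun q hq => by
          rwa [show q = w from Fin.ext (by omega)]) (by
          rw [show 2 * (q + 1) = 2 * q + 2 by ring] at hs1; omega) hs3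
      refine ⟨u, hu3, lt_of_le_of_lt hu2 hs2, fun p hp => ?_⟩
      have : τ (2 * p + 1) ≤ τ (2 * q + 1) := hτ (by simp only at hp; omega)
      omega
  choose u hu hlt hle using key
  have hinj : Function.Injective u := by
    have aux : ∀ p q : Fin n, p < q → u p ≠ u q := fun p q hpq he => by
      have h1 := hlt p
      have h2 := hle q p hpq
      rw [he] at h1
      omega
    intro p q he
    rcases lt_trichotomy p q with h1 | h1 | h1
    · exact absurd he (aux p q h1)
    · exact h1
    · exact absurd he.symm (aux q p h1)
  calc n = (Finset.univ : Finset (Fin n)).card := by simp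
    _ ≤ _ := Finset.card_le_card_of_injOn u (fun q _ => by simpa using hu q) hinj.injOn

/-! ### Few re-switches force large regret. -/

/-- The environment with Gaussian rewards in which the actions in `B` have mean `δ` and the others
have mean `0`. -/
noncomputable def gapEnv {k : ℕ} (B : Set (Fin k)) (δ : ℝ) (h0 : 0 ≤ δ) (h1 : δ ≤ 1) : Env k :=
  gaussianEnv (B.indicator fun _ => δ) fun i j => by
    classical
    simp only [Set.indicator_apply]
    rw [abs_le]
    split_ifs <;> constructor <;> linarith

/-- The environment in which all rewards are standard Gaussian. -/
noncomputable def zeroEnv (k : ℕ) : Env k := gaussianEnv (fun _ => 0) fun i j => by simp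

/-- Neglecting `B` during [u, v) costs δ per round once `B` is best; the exponential is the price of
moving the event from `zeroEnv` to `gapEnv`. -/
theorem regretIn_gapEnv_ge {k : ℕ} (ρ : Policy k) (B : Set (Fin k)) (hB : B.Nonempty) {δ : ℝ}
    (h0 : 0 ≤ δ) (h1 : δ ≤ 1) {u v T : ℕ} (huv : u ≤ v) (hv : v ≤ T) :
    δ * (v - u) * Real.exp (-(δ ^ 2 * u)) *
      ((law ρ (zeroEnv k) T).real
        {h | ∀ s : Fin T, u ≤ s → s < v → (h s).1 ∉ B}) ^ 2 ≤
      regretIn ρ (gapEnv B δ h0 h1) T := by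
  classical
  set D' := gapEnv B δ h0 h1 with hD'
  set E : Set (Hist k v) := {h | ∀ s : Fin v, u ≤ s → (h s).1 ∉ B}
  set E' : Set (Hist k T) := {h | ∀ s : Fin T, u ≤ s → s < v → (h s).1 ∉ B}
  have mE : MeasurableSet E := measurableSet_actions fun a => ∀ s : Fin v, u ≤ s → a s ∉ B
  have mE' : MeasurableSet E' :=
    measurableSet_actions fun a => ∀ s : Fin T, u ≤ s → s < v → a s ∉ B
  -- Truncating at `v` is needed because `B` may be chosen again afterwards, while the change of
  -- environment requires `B` to be avoided from `u` to the end.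
  have hmarg : ∀ D : Env k, law ρ D T E' = law ρ D v E := by
    intro D
    rw [← lintegral_indicator_one mE, ← lintegral_indicator_one mE',
      ← lintegral_law_castLE ρ D hv (measurable_one.indicator mE)]
    refine lintegral_congr fun h => ?_
    have : h ∈ E' ↔ (fun s => h (Fin.castLE hv s)) ∈ E :=
      ⟨fun hh s hs => hh (Fin.castLE hv s) hs s.2, fun hh s hs hsv => hh ⟨s, hsv⟩ hs⟩
    simp only [Set.indicator_apply, this, Pi.one_apply]
  have hcomp : (law ρ (zeroEnv k) T E') ^ 2 ≤
      ENNReal.ofReal (Real.exp (δ ^ 2)) ^ u * law ρ D' T E' := by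
    rw [hmarg, hmarg]
    have := gaussianEnv_law_sq_le ρ (m := fun _ => 0) (m' := B.indicator fun _ => δ)
      (fun i j => by simp) (fun i j => by
        simp only [Set.indicator_apply]
        rw [abs_le]
        split_ifs <;> constructor <;> linarith) (δ := δ)
      (fun a => by
        simp only [Set.indicator_apply]
        split_ifs <;> simp [sq_nonneg]) B (fun a ha => by simp [ha]) u v mE (fun h hh => hh)
    rwa [min_eq_right huv] at this
  have hreal : ((law ρ (zeroEnv k) T).real E') ^ 2 ≤
      Real.exp (δ ^ 2 * u) * (law ρ D' T).real E' := by
    have hfin : ENNReal.ofReal (Real.exp (δ ^ 2)) ^ u * law ρ D' T E' ≠ ⊤ :=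
      ENNReal.mul_ne_top (ENNReal.pow_ne_top ENNReal.ofReal_ne_top) (measure_ne_top _ _)
    have := ENNReal.toReal_mono hfin hcomp
    rw [ENNReal.toReal_mul, ENNReal.toReal_pow, ENNReal.toReal_pow,
      ENNReal.toReal_ofReal (Real.exp_pos _).le, ← Real.exp_nat_mul, mul_comm (u : ℝ)] at this
    exact this
  have hmean : ∀ a, D'.mean a = B.indicator (fun _ => δ) a := fun a => gaussianEnv_mean _ _ a
  obtain ⟨b, hb⟩ := hB
  have hgap : ∀ a, a ∉ B → δ ≤ D'.best - D'.mean a := by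
    intro a ha
    have := D'.mean_le_best b
    rw [hmean, Set.indicator_of_mem hb] at this
    rw [hmean a, Set.indicator_of_notMem ha]
    linarith
  have hlow : ∀ h : Hist k T, E'.indicator (fun _ => δ * (v - u)) h ≤
      ∑ t, (D'.best - D'.mean (h t).1) := by
    intro h
    by_cases hh : h ∈ E'
    · rw [Set.indicator_of_mem hh]
      calc δ * ((v : ℝ) - u) = ∑ s : Fin T, if u ≤ (s : ℕ) ∧ (s : ℕ) < v then δ else 0 := by
            rw [Fin.sum_univ_eq_sum_range (fun s : ℕ => if u ≤ s ∧ s < v then δ else 0),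
              ← Finset.sum_filter,
              show (Finset.range T).filter (fun s => u ≤ s ∧ s < v) = Finset.Ico u v by
                ext s; simp; omega]
            simp [Nat.cast_sub huv, mul_comm]
        _ ≤ _ := by
            refine Finset.sum_le_sum fun s _ => ?_
            split_ifs with hs
            · exact hgap _ (hh s hs.1 hs.2)
            · exact sub_nonneg.2 (D'.mean_le_best _)
    · rw [Set.indicator_of_notMem hh]
      exact Finset.sum_nonneg fun s _ => sub_nonneg.2 (D'.mean_le_best _)
  have hint : (law ρ D' T).real E' * (δ * (v - u)) ≤ regretIn ρ D' T := by
    rw [regretIn_eq, ← smul_eq_mul, ← integral_indicator_const _ mE']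
    exact integral_mono ((integrable_const _).indicator mE')
      (integrable_finsetSum _ fun t _ => (integrable_const _).sub (integrable_action ρ D' _ t))
      hlow
  refine le_trans ?_ hint
  have huv' : (0 : ℝ) ≤ v - u := sub_nonneg.2 (by exact_mod_cast huv)
  calc δ * (v - u) * Real.exp (-(δ ^ 2 * u)) * ((law ρ (zeroEnv k) T).real E') ^ 2
      ≤ δ * (v - u) * Real.exp (-(δ ^ 2 * u)) *
          (Real.exp (δ ^ 2 * u) * (law ρ D' T).real E') := by gcongr
    _ = (Real.exp (-(δ ^ 2 * u)) * Real.exp (δ ^ 2 * u)) *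
          ((law ρ D' T).real E' * (δ * (v - u))) := by ring
    _ = _ := by rw [← Real.exp_add]; simp

/-- If almost surely some action is re-switched fewer than `n` times, the regret is large in some
environment, whatever the grid of rounds. -/
theorem exists_regret_ge {k : ℕ} (hk : 2 ≤ k) (ρ : Policy k) {T n : ℕ} (hn : 1 ≤ n)
    (hnull : law ρ (zeroEnv k) T {h | ∀ j, n ≤ reswitches h j} = 0)
    {τ : ℕ → ℕ} (hτ : Monotone τ) (hT : τ (2 * n - 1) ≤ T) (δ : ℕ → ℝ) (h0 : ∀ r, 0 ≤ δ r)
    (h1 : ∀ r, δ r ≤ 1) :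
    ∃ r < 2 * n - 1,
      ((δ r * (τ (r + 1) - τ r) * Real.exp (-(δ r ^ 2 * τ r)) * (1 / (k * (2 * n - 1))) ^ 2 : ℝ) :
        EReal) ≤ regret ρ T := by
  classical
  -- Avoiding `B r j` means neglecting `j` for even `r`, and sticking to `j` for odd `r`.
  set B : ℕ → Fin k → Set (Fin k) := fun r j => if Even r then {j} else {j}ᶜ with hBdef
  set E : ℕ → Fin k → Set (Hist k T) := fun r j =>
    {h | ∀ s : Fin T, τ r ≤ s → s < τ (r + 1) → (h s).1 ∉ B r j} with hEdef
  set μ := law ρ (zeroEnv k) T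
  have hBne : ∀ r j, (B r j).Nonempty := by
    intro r j
    simp only [hBdef]
    split_ifs
    · exact ⟨j, rfl⟩
    · have : Nontrivial (Fin k) := Fin.nontrivial_iff_two_le.2 hk
      obtain ⟨i, hi⟩ := exists_ne j
      exact ⟨i, hi⟩
  have hcover : (Set.univ : Set (Hist k T)) ⊆ {h | ∀ j, n ≤ reswitches h j} ∪
      ⋃ p ∈ Finset.range (2 * n - 1) ×ˢ (Finset.univ : Finset (Fin k)), E p.1 p.2 := by
    intro h _
    by_contra hcon
    simp only [Set.mem_union, not_or, Set.mem_iUnion, not_exists] at hcon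
    obtain ⟨hc1, hc2⟩ := hcon
    refine hc1 fun j => le_reswitches h j hτ (fun q hq => ?_) fun q hq => ?_
    · have := hc2 (2 * q, j) (by simp; omega)
      simp only [hEdef, hBdef, Set.mem_ofPred_eq] at this
      push Not at this
      obtain ⟨s, hs1, hs2, hs3⟩ := this
      exact ⟨s, hs1, hs2, by simpa using hs3⟩
    · have := hc2 (2 * q + 1, j) (by simp; omega)
      simp only [hEdef, hBdef, Set.mem_ofPred_eq] at this
      push Not at this
      obtain ⟨s, hs1, hs2, hs3⟩ := this
      exact ⟨s, hs1, hs2, by simpa using hs3⟩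
  have hsum : 1 ≤ ∑ p ∈ Finset.range (2 * n - 1) ×ˢ (Finset.univ : Finset (Fin k)),
      μ.real (E p.1 p.2) := by
    calc (1 : ℝ) = μ.real Set.univ := by simp
      _ ≤ μ.real ({h | ∀ j, n ≤ reswitches h j} ∪
        ⋃ p ∈ Finset.range (2 * n - 1) ×ˢ (Finset.univ : Finset (Fin k)), E p.1 p.2) :=
          measureReal_mono hcover
      _ ≤ μ.real {h | ∀ j, n ≤ reswitches h j} + μ.real
        (⋃ p ∈ Finset.range (2 * n - 1) ×ˢ (Finset.univ : Finset (Fin k)), E p.1 p.2) :=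
          measureReal_union_le _ _
      _ = μ.real (⋃ p ∈ Finset.range (2 * n - 1) ×ˢ (Finset.univ : Finset (Fin k)),
            E p.1 p.2) := by simp [measureReal_def, hnull]
      _ ≤ _ := measureReal_biUnion_finset_le _ _
  have hkpos : (0 : ℝ) < k := by exact_mod_cast (by omega : 0 < k)
  have hnpos : (0 : ℝ) < 2 * n - 1 := by
    have : (1 : ℝ) ≤ n := by exact_mod_cast hn
    linarith
  have hne : (Finset.range (2 * n - 1) ×ˢ (Finset.univ : Finset (Fin k))).Nonempty :=
    ⟨(0, ⟨0, by omega⟩), by simp; omega⟩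
  -- Pigeonhole over the k(2n-1) failure events.
  obtain ⟨⟨r, j⟩, hp, hle⟩ := Finset.exists_le_of_sum_le hne
    (f := fun _ => (1 : ℝ) / (k * (2 * n - 1))) (g := fun p => μ.real (E p.1 p.2)) (by
      refine le_trans (le_of_eq ?_) hsum
      rw [Finset.sum_const, Finset.card_product, Finset.card_range, Finset.card_univ,
        Fintype.card_fin, nsmul_eq_mul, Nat.cast_mul, Nat.cast_sub (by omega)]
      push_cast
      field_simp)
  have hr : r < 2 * n - 1 := by simpa using hp
  refine ⟨r, hr, le_trans (EReal.coe_le_coe_iff.2 (le_trans ?_ (regretIn_gapEnv_ge ρ (B r j)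
    (hBne r j) (h0 r) (h1 r) (hτ (Nat.le_succ r)) ((hτ (by omega)).trans hT))))
    (regretIn_le_regret ρ (gapEnv (B r j) (δ r) (h0 r) (h1 r)) T)⟩
  have hmono : (0 : ℝ) ≤ τ (r + 1) - τ r := sub_nonneg.2 (by exact_mod_cast hτ (Nat.le_succ r))
  have := h0 r
  gcongr

/-- The lower bound on the regret, for the grid of rounds that balances the intervals. -/
theorem regret_ge_rpow {k : ℕ} (hk : 2 ≤ k) (ρ : Policy k) {T n : ℕ} (hT : 1 ≤ T) (hn : 1 ≤ n)
    (hnull : law ρ (zeroEnv k) T {h | ∀ j, n ≤ reswitches h j} = 0)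
    (hbig : 4 ≤ (T : ℝ) ^ ((1 / 2 : ℝ) ^ (2 * n - 2) / 2)) :
    ((Real.exp (-1) / 2 * (T : ℝ) ^ (1 / (2 - (1 / 2 : ℝ) ^ (2 * n - 2))) *
      (1 / (k * (2 * n - 1))) ^ 2 : ℝ) : EReal) ≤ regret ρ T := by
  set ε : ℝ := (1 / 2 : ℝ) ^ (2 * n - 2) with hε
  have hε0 : 0 < ε := by positivity
  have hε1 : ε ≤ 1 := pow_le_one₀ (by norm_num) (by norm_num)
  set a : ℝ := 1 / (2 - ε) with ha
  have ha2 : 1 / 2 ≤ a := by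
    rw [ha]
    exact one_div_le_one_div_of_le (by linarith) (by linarith)
  have haε : a * (2 - ε) = 1 := by rw [ha]; field_simp [show (2 - ε) ≠ 0 by linarith]
  have hT1 : (1 : ℝ) ≤ T := by exact_mod_cast hT
  have hT0 : (0 : ℝ) < T := by linarith
  -- The solution of x(r+1) - x(r)/2 = a with x(0) = 0; the value of `a` makes x(2n-1) = 1. With gap
  -- T^(-x(r)/2), every interval then costs about T^a.
  set x : ℕ → ℝ := fun r => a * (2 - 2 * (1 / 2 : ℝ) ^ r) with hx
  have hxmono : Monotone x := by
    refine monotone_nat_of_le_succ fun r => ?_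
    simp only [hx, pow_succ]
    have : (0 : ℝ) < (1 / 2) ^ r := by positivity
    nlinarith
  have hx0 : ∀ r, 0 ≤ x r := fun r => by
    have := hxmono (Nat.zero_le r)
    simpa [hx] using this
  have hlast : x (2 * n - 1) = 1 := by
    rw [← haε, hε, hx]
    simp only
    rw [show 2 * n - 1 = (2 * n - 2) + 1 by omega, pow_succ]
    ring
  set τ : ℕ → ℕ := fun r => ⌊(T : ℝ) ^ x r⌋₊ with hτ
  have hτmono : Monotone τ := fun r s hrs =>
    Nat.floor_mono (Real.rpow_le_rpow_of_exponent_le hT1 (hxmono hrs))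
  obtain ⟨r, hr, hreg⟩ := exists_regret_ge hk ρ hn hnull hτmono
    (by simp only [hτ]; rw [hlast]; simp) (fun r => (T : ℝ) ^ (-(x r / 2)))
    (fun r => by positivity)
    (fun r => Real.rpow_le_one_of_one_le_of_nonpos hT1 (by linarith [hx0 r]))
  refine le_trans (EReal.coe_le_coe_iff.2 ?_) hreg
  have hfl : (τ r : ℝ) ≤ (T : ℝ) ^ x r := Nat.floor_le (by positivity)
  have hfl' : (T : ℝ) ^ x (r + 1) - 1 < τ (r + 1) := Nat.sub_one_lt_floor _
  have hpow : (1 / 2 : ℝ) ^ (2 * n - 2) ≤ (1 / 2) ^ r :=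
    pow_le_pow_of_le_one (by norm_num) (by norm_num) (by omega)
  -- The exponent grows by a·2^(-r) ≥ ε/2, so `hbig` separates neighbouring grid points by a factor
  -- 4, which absorbs the floors.
  have hstep : (T : ℝ) ^ x r * 4 ≤ (T : ℝ) ^ x (r + 1) := by
    have e : x (r + 1) = x r + a * (1 / 2) ^ r := by simp only [hx, pow_succ]; ring
    rw [e, Real.rpow_add hT0]
    gcongr
    refine hbig.trans (Real.rpow_le_rpow_of_exponent_le hT1 ?_)
    rw [← hε] at hpow
    nlinarith
  have hone : 1 ≤ (T : ℝ) ^ x r := Real.one_le_rpow hT1 (hx0 r)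
  have hlen : (T : ℝ) ^ x (r + 1) / 2 ≤ τ (r + 1) - τ r := by linarith
  have hexp : Real.exp (-1) ≤ Real.exp (-(((T : ℝ) ^ (-(x r / 2))) ^ 2 * τ r)) := by
    refine Real.exp_le_exp.2 (neg_le_neg ?_)
    calc ((T : ℝ) ^ (-(x r / 2))) ^ 2 * τ r ≤ ((T : ℝ) ^ (-(x r / 2))) ^ 2 * (T : ℝ) ^ x r := by
          gcongr
      _ = 1 := by
          rw [← Real.rpow_natCast, ← Real.rpow_mul hT0.le, ← Real.rpow_add hT0]
          convert Real.rpow_zero _ using 2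
          push_cast
          ring
  have hmain : (T : ℝ) ^ a / 2 = (T : ℝ) ^ (-(x r / 2)) * ((T : ℝ) ^ x (r + 1) / 2) := by
    rw [← mul_div_assoc, ← Real.rpow_add hT0]
    congr 2
    simp only [hx, pow_succ]
    ring
  have hmul : Real.exp (-1) / 2 * (T : ℝ) ^ a ≤ (T : ℝ) ^ (-(x r / 2)) * (τ (r + 1) - τ r) *
      Real.exp (-(((T : ℝ) ^ (-(x r / 2))) ^ 2 * τ r)) := by
    calc Real.exp (-1) / 2 * (T : ℝ) ^ a = ((T : ℝ) ^ a / 2) * Real.exp (-1) := by ring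
      _ ≤ _ := by
        have h0 : 0 ≤ (T : ℝ) ^ (-(x r / 2)) * (τ (r + 1) - τ r) :=
          mul_nonneg (by positivity) (le_trans (by positivity) hlen)
        rw [hmain]
        gcongr
  gcongr

/-! ### Necessity of re-switches. -/

/-- Positive probability in `zeroEnv` carries over to the Gaussian environment where `i` has mean 0
and all others mean 1. -/
theorem needs_of_eventually {k : ℕ} (π : ℕ → Policy k) (n : ℕ → ℕ) {ν : ℕ → ℝ}
    (hν : ∀ T, ν T ≤ n T)
    (h : ∀ᶠ T in atTop, law (π T) (zeroEnv k) T {h | ∀ j, n T ≤ reswitches h j} ≠ 0) :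
    Needs π ν := by
  classical
  filter_upwards [h] with T hT i
  have hm : ∀ a b : Fin k,
      |(if a = i then (0 : ℝ) else 1) - (if b = i then (0 : ℝ) else 1)| ≤ 1 := by
    intro a b
    split_ifs <;> simp
  refine ⟨gaussianEnv (fun a => if a = i then 0 else 1) hm, fun j hj => ?_, ?_⟩
  · rw [gaussianEnv_mean, gaussianEnv_mean]
    simp [hj]
  · refine pos_iff_ne_zero.2 fun h0 => hT (gaussianEnv_law_null (π T) _ hm
      (measurableSet_actions fun a => ∀ j, n T ≤ (Finset.univ.filter fun t : Fin T =>
        a t = j ∧ ∀ s : Fin T, (s : ℕ) + 1 = t → a s ≠ j).card) (measure_mono_null ?_ h0))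
    exact fun h hh j => (hν T).trans (Nat.cast_le.2 (hh j))

theorem needs_of_achievesRegret {k : ℕ} (hk : 2 ≤ k) {π : ℕ → Policy k} {a : ℝ}
    (hπ : AchievesRegret π a) (n : ℕ → ℕ) {ν : ℕ → ℝ} (hν : ∀ T, ν T ≤ n T)
    (hn : ∀ᶠ T in atTop, 1 ≤ n T)
    (hbig : ∀ᶠ T : ℕ in atTop, 4 ≤ (T : ℝ) ^ ((1 / 2 : ℝ) ^ (2 * n T - 2) / 2))
    (hgrow : ∀ (C : ℝ) (p : ℕ), ∀ᶠ T : ℕ in atTop, C * Real.log T ^ p * (T : ℝ) ^ a <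
      Real.exp (-1) / 2 * (T : ℝ) ^ (1 / (2 - (1 / 2 : ℝ) ^ (2 * n T - 2))) *
        (1 / (k * (2 * n T - 1))) ^ 2) : Needs π ν := by
  obtain ⟨C, p, hC⟩ := hπ
  refine needs_of_eventually π n hν ?_
  filter_upwards [hC, hn, hbig, hgrow C p, eventually_ge_atTop 1] with T h1 h2 h3 h4 h5 h0
  have := (regret_ge_rpow hk (π T) h5 h2 h0 h3).trans h1
  exact absurd (EReal.coe_le_coe_iff.1 this) (not_le.2 h4)

theorem tendsto_log_natCast : Tendsto (fun T : ℕ => Real.log T) atTop atTop :=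
  Real.tendsto_log_atTop.comp tendsto_natCast_atTop_atTop

theorem tendsto_loglog_natCast : Tendsto (fun T : ℕ => Real.log (Real.log T)) atTop atTop :=
  Real.tendsto_log_atTop.comp tendsto_log_natCast

theorem needs_ceil_half {k : ℕ} (hk : 2 ≤ k) {N : ℕ} (hN : 1 ≤ N) {π : ℕ → Policy k}
    (hπ : AchievesRegret π (1 / (2 - (2 : ℝ) ^ (-(N : ℤ))))) :
    Needs π (fun _ => (⌈(N : ℝ) / 2⌉ : ℝ)) := by
  -- This is ⌈N/2⌉. Since 2n-2 < N, the lower bound has a strictly larger exponent, and a positive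
  -- power of T beats the logarithms.
  set n : ℕ := (N + 1) / 2 with hn
  have hn1 : 1 ≤ n := by omega
  have hnN : 2 * n - 2 < N := by omega
  have hpow : (2 : ℝ) ^ (-(N : ℤ)) = (1 / 2) ^ N := by simp
  rw [hpow] at hπ
  have hlt : (1 / 2 : ℝ) ^ N < (1 / 2) ^ (2 * n - 2) :=
    pow_lt_pow_right_of_lt_one₀ (by norm_num) (by norm_num) hnN
  have hle : (1 / 2 : ℝ) ^ (2 * n - 2) ≤ 1 := pow_le_one₀ (by norm_num) (by norm_num)
  have hε0 : (0 : ℝ) < (1 / 2) ^ (2 * n - 2) := by positivity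
  set ε : ℝ := (1 / 2) ^ (2 * n - 2)
  set η : ℝ := (1 / 2) ^ N
  have hexp : 1 / (2 - η) < 1 / (2 - ε) :=
    one_div_lt_one_div_of_lt (by linarith) (by linarith)
  have hk0 : (0 : ℝ) < k := by exact_mod_cast (by omega : 0 < k)
  have hn0 : (0 : ℝ) < 2 * n - 1 := by
    have : (1 : ℝ) ≤ n := by exact_mod_cast hn1
    linarith
  refine needs_of_achievesRegret hk hπ (fun _ => n) (fun _ => ?_)
    (Eventually.of_forall fun _ => hn1)
    (((tendsto_rpow_atTop (half_pos hε0)).comp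
      tendsto_natCast_atTop_atTop).eventually_ge_atTop 4) fun C p => ?_
  · have h1 : ⌈(N : ℝ) / 2⌉ ≤ (n : ℤ) := by
      rw [Int.ceil_le]
      have : (N : ℝ) ≤ 2 * n := by exact_mod_cast (by omega : N ≤ 2 * n)
      push_cast
      linarith
    exact_mod_cast h1
  · set c : ℝ := Real.exp (-1) / 2 * (1 / (k * (2 * n - 1))) ^ 2 with hc
    have hc0 : 0 < c := by positivity
    have ho := (isLittleO_log_rpow_rpow_atTop (p : ℝ) (sub_pos.2 hexp)).def
      (show 0 < c / (|C| + 1) by positivity)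
    filter_upwards [tendsto_natCast_atTop_atTop.eventually ho, eventually_ge_atTop 1,
      tendsto_log_natCast.eventually_ge_atTop 1] with T hT hT1 hlog
    have hT0 : (0 : ℝ) < T := by exact_mod_cast hT1
    rw [Real.rpow_natCast, Real.norm_of_nonneg (by positivity),
      Real.norm_of_nonneg (by positivity), div_mul_eq_mul_div, le_div_iff₀ (by positivity)] at hT
    have hlp : 0 < Real.log T ^ p := by positivity
    have hs : (T : ℝ) ^ (1 / (2 - ε)) =
        (T : ℝ) ^ (1 / (2 - ε) - 1 / (2 - η)) * (T : ℝ) ^ (1 / (2 - η)) := by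
      rw [← Real.rpow_add hT0]
      ring_nf
    have hlt' : C * Real.log T ^ p < c * (T : ℝ) ^ (1 / (2 - ε) - 1 / (2 - η)) :=
      lt_of_lt_of_le (by nlinarith [le_abs_self C]) hT
    calc C * Real.log T ^ p * (T : ℝ) ^ (1 / (2 - η))
        < c * (T : ℝ) ^ (1 / (2 - ε) - 1 / (2 - η)) * (T : ℝ) ^ (1 / (2 - η)) := by gcongr
      _ = _ := by rw [hs, hc]; ring

/-- The factor 1/4 gives 2n-2 ≤ (log log T)/2, hence ε = 2^(-(2n-2)) ≥ (log T)^(-1/2). As 1/(2-ε) ≥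
1/2 + ε/4, the lower bound gains exp(√(log T)/4) over √T, which beats every power of log T. -/
theorem needs_loglog {k : ℕ} (hk : 2 ≤ k) {π : ℕ → Policy k}
    (hπ : AchievesRegret π (1 / 2)) :
    Needs π (fun T => 1 / 4 * Real.log (Real.log T)) := by
  set n : ℕ → ℕ := fun T => ⌈1 / 4 * Real.log (Real.log T)⌉₊ with hn
  have hk0 : (0 : ℝ) < k := by exact_mod_cast (by omega : 0 < k)
  have hpos := tendsto_loglog_natCast.eventually_gt_atTop 0
  have hn1 : ∀ᶠ T in atTop, 1 ≤ n T := by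
    filter_upwards [hpos] with T hT
    exact Nat.ceil_pos.2 (by positivity)
  have hy : Tendsto (fun T : ℕ => √(Real.log T)) atTop atTop :=
    Real.tendsto_sqrt_atTop.comp tendsto_log_natCast
  have hεlog : ∀ᶠ T : ℕ in atTop,
      √(Real.log T) ≤ Real.log T * (1 / 2 : ℝ) ^ (2 * n T - 2) := by
    filter_upwards [hpos, hn1, tendsto_log_natCast.eventually_gt_atTop 0] with T hT h1 hlog
    set l := Real.log (Real.log T) with hl
    have hceil : (n T : ℝ) < 1 / 4 * l + 1 := Nat.ceil_lt_add_one (by positivity)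
    have hcast : ((2 * n T - 2 : ℕ) : ℝ) ≤ l / 2 := by
      rw [Nat.cast_sub (by omega)]
      push_cast
      linarith
    have h2 : Real.exp (-1) ≤ 1 / 2 := by
      rw [Real.exp_neg, ← one_div]
      exact one_div_le_one_div_of_le (by norm_num) (by linarith [Real.exp_one_gt_d9])
    have hL : Real.log T = Real.exp l := (Real.exp_log hlog).symm
    calc √(Real.log T) = Real.exp l * Real.exp (-(l / 2)) := by
          rw [hL, ← Real.exp_add, ← Real.exp_half]
          ring_nf
      _ ≤ Real.log T * (1 / 2 : ℝ) ^ (2 * n T - 2) := by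
          rw [← hL]
          gcongr
          calc Real.exp (-(l / 2)) ≤ Real.exp (((2 * n T - 2 : ℕ) : ℝ) * (-1)) :=
                Real.exp_le_exp.2 (by linarith)
            _ = Real.exp (-1) ^ (2 * n T - 2) := Real.exp_nat_mul _ _
            _ ≤ _ := by gcongr
  refine needs_of_achievesRegret hk hπ n (fun T => Nat.le_ceil _) hn1 ?_ fun C p => ?_
  · filter_upwards [hεlog, hy.eventually_ge_atTop 6, eventually_ge_atTop 1] with T h1 h2 h3
    have hT0 : (0 : ℝ) < T := by exact_mod_cast h3
    rw [Real.rpow_def_of_pos hT0]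
    have := Real.add_one_le_exp (Real.log T * ((1 / 2 : ℝ) ^ (2 * n T - 2) / 2))
    linarith
  · set c : ℝ := Real.exp (-1) / 2 * (1 / k) ^ 2 with hc
    have hc0 : 0 < c := by positivity
    -- In the variable √(log T): 2p for the assumed logarithmic power, 4 for the factor (2n-1)² ≤
    -- (log T)².
    have ho := (isLittleO_pow_exp_pos_mul_atTop (2 * p + 4) (b := 1 / 4) (by norm_num)).def
      (show 0 < c / (|C| + 1) by positivity)
    filter_upwards [hy.eventually ho, hεlog, hn1, hpos, eventually_ge_atTop 1,
      tendsto_log_natCast.eventually_ge_atTop 2] with T hT hε h1 hll hT1 hlog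
    have hT0 : (0 : ℝ) < T := by exact_mod_cast hT1
    rw [Real.norm_of_nonneg (by positivity), Real.norm_of_nonneg (by positivity),
      div_mul_eq_mul_div, le_div_iff₀ (by positivity)] at hT
    have hn0 : (1 : ℝ) ≤ n T := by exact_mod_cast h1
    have hceil : (n T : ℝ) < 1 / 4 * Real.log (Real.log T) + 1 :=
      Nat.ceil_lt_add_one (by positivity)
    have hll' : Real.log (Real.log T) ≤ Real.log T - 1 :=
      Real.log_le_sub_one_of_pos (by linarith)
    have hnL : 2 * (n T : ℝ) - 1 ≤ Real.log T := by linarith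
    set L := Real.log T with hL
    set ε : ℝ := (1 / 2 : ℝ) ^ (2 * n T - 2) with hεdef
    have hε0 : 0 < ε := by positivity
    have hε1 : ε ≤ 1 := pow_le_one₀ (by norm_num) (by norm_num)
    have hpowL : √L ^ (2 * p + 4) = L ^ p * L ^ 2 := by
      rw [show 2 * p + 4 = 2 * (p + 2) by ring, pow_mul, Real.sq_sqrt (by linarith), pow_add]
    have hexpo : Real.exp (1 / 4 * √L) * (T : ℝ) ^ (1 / 2 : ℝ) ≤ (T : ℝ) ^ (1 / (2 - ε)) := by
      rw [Real.rpow_def_of_pos hT0, Real.rpow_def_of_pos hT0, ← Real.exp_add]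
      refine Real.exp_le_exp.2 ?_
      have hle : 1 / 2 + ε / 4 ≤ 1 / (2 - ε) := by
        rw [le_div_iff₀ (by linarith)]
        nlinarith
      have := mul_le_mul_of_nonneg_left hle (show 0 ≤ L by linarith)
      linarith
    have hlt : C * L ^ p * L ^ 2 < c * Real.exp (1 / 4 * √L) := by
      refine lt_of_lt_of_le ?_ hT
      rw [hpowL, mul_assoc, mul_comm (L ^ p * L ^ 2)]
      gcongr
      linarith [le_abs_self C]
    have hden : (1 / (k * L)) ^ 2 ≤ (1 / (k * (2 * n T - 1)) : ℝ) ^ 2 := by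
      have : (0 : ℝ) < 2 * n T - 1 := by linarith
      gcongr
    calc C * L ^ p * (T : ℝ) ^ (1 / 2 : ℝ)
        = C * L ^ p * L ^ 2 * (1 / L) ^ 2 * (T : ℝ) ^ (1 / 2 : ℝ) := by
          field_simp
      _ < c * Real.exp (1 / 4 * √L) * (1 / L) ^ 2 * (T : ℝ) ^ (1 / 2 : ℝ) := by
          gcongr
      _ = Real.exp (-1) / 2 * (Real.exp (1 / 4 * √L) * (T : ℝ) ^ (1 / 2 : ℝ)) *
            (1 / (k * L)) ^ 2 := by
          rw [hc]
          field_simp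
      _ ≤ _ := by gcongr

/-! ### Concentration of centred rewards. -/

theorem measurable_noise {k t : ℕ} (D : Env k) (S : Finset ℕ) :
    Measurable fun h : Hist k t =>
      ∑ s : Fin t, if (s : ℕ) ∈ S then (h s).2 - D.mean (h s).1 else 0 := by
  refine Finset.measurable_sum _ fun s _ => ?_
  split_ifs
  · exact (measurable_snd.comp (measurable_pi_apply s)).sub
      ((measurable_of_finite D.mean).comp (measurable_action s))
  · exact measurable_const

/-- The centred rewards of any deterministic set of rounds are jointly sub-Gaussian. -/
theorem lintegral_exp_noise_le {k : ℕ} (ρ : Policy k) (D : Env k) (S : Finset ℕ) (θ : ℝ) (t : ℕ) :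
    ∫⁻ h, ENNReal.ofReal (Real.exp (θ * ∑ s : Fin t,
      if (s : ℕ) ∈ S then (h s).2 - D.mean (h s).1 else 0)) ∂(law ρ D t) ≤
      ENNReal.ofReal (Real.exp (θ ^ 2 / 2)) ^ (S.filter (· < t)).card := by
  have hprob := D.isProb
  induction t with
  | zero => simp [law]
  | succ t ih =>
    have hm : Measurable fun h : Hist k (t + 1) => ENNReal.ofReal (Real.exp (θ * ∑ s : Fin (t + 1),
        if (s : ℕ) ∈ S then (h s).2 - D.mean (h s).1 else 0)) :=
      (((measurable_noise D S).const_mul θ).exp).ennreal_ofReal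
    rw [lintegral_law_succ ρ D t hm]
    simp only [Fin.sum_univ_castSucc, Fin.snoc_castSucc, Fin.snoc_last, Fin.val_castSucc,
      Fin.val_last, mul_add, Real.exp_add, ENNReal.ofReal_mul (Real.exp_pos _).le]
    -- The bound is uniform in the action, so adaptivity is harmless and rounds integrate out one by
    -- one.
    have hinner : ∀ a : Fin k, ∫⁻ x, ENNReal.ofReal
        (Real.exp (θ * if t ∈ S then x - D.mean a else 0)) ∂(D.dist a) ≤
        if t ∈ S then ENNReal.ofReal (Real.exp (θ ^ 2 / 2)) else 1 := by
      intro a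
      split_ifs
      · have h1 := D.subGaussian a
        have h2 := h1.mgf_le θ
        rw [mgf] at h2
        have h3 := ofReal_integral_eq_lintegral_ofReal (h1.integrable_exp_mul θ)
          (Eventually.of_forall fun x => (Real.exp_pos _).le)
        refine (le_of_eq h3.symm).trans (ENNReal.ofReal_le_ofReal ?_)
        simpa using h2
      · simp
    have hcard : ENNReal.ofReal (Real.exp (θ ^ 2 / 2)) ^ (S.filter (· < t + 1)).card =
        ENNReal.ofReal (Real.exp (θ ^ 2 / 2)) ^ (S.filter (· < t)).card *
          if t ∈ S then ENNReal.ofReal (Real.exp (θ ^ 2 / 2)) else 1 := by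
      split_ifs with hS
      · rw [← pow_succ]
        congr 1
        rw [show S.filter (· < t + 1) = insert t (S.filter (· < t)) by
          ext s; simp only [Finset.mem_filter, Finset.mem_insert]
          constructor
          · rintro ⟨h1, h2⟩
            rcases Nat.lt_succ_iff_lt_or_eq.1 h2 with h3 | h3
            · exact Or.inr ⟨h1, h3⟩
            · exact Or.inl h3
          · rintro (rfl | ⟨h1, h2⟩)
            · exact ⟨hS, Nat.lt_succ_self _⟩
            · exact ⟨h1, by omega⟩]
        rw [Finset.card_insert_of_notMem (by simp)]
      · rw [mul_one]
        congr 2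
        refine Finset.filter_congr fun s hs => ?_
        have : s ≠ t := fun h => hS (h ▸ hs)
        omega
    rw [hcard]
    refine le_trans ?_ (mul_le_mul_left ih _)
    rw [← lintegral_mul_const _
      ((((measurable_noise D S).const_mul θ).exp).ennreal_ofReal)]
    refine lintegral_mono fun h => ?_
    have hmx : ∀ a : Fin k, Measurable fun x : ℝ => ENNReal.ofReal
        (Real.exp (θ * if t ∈ S then x - D.mean a else 0)) := fun a => by
      split_ifs <;> fun_prop
    simp_rw [lintegral_const_mul _ (hmx _)]
    rw [lintegral_const_mul _ (measurable_of_finite _)]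
    gcongr
    refine (lintegral_mono hinner).trans ?_
    simp

/-- The tail bound for the centred rewards of a set of `b` rounds. -/
theorem noise_tail {k : ℕ} (ρ : Policy k) (D : Env k) (S : Finset ℕ) {b : ℕ} (hS : S.card ≤ b)
    {r : ℝ} (hr : 0 ≤ r) (t : ℕ) :
    (law ρ D t).real {h | b * r < |∑ s : Fin t,
      if (s : ℕ) ∈ S then (h s).2 - D.mean (h s).1 else 0|} ≤ 2 * Real.exp (-(b * r ^ 2 / 2)) := by
  set Z : Hist k t → ℝ := fun h => ∑ s : Fin t,
      if (s : ℕ) ∈ S then (h s).2 - D.mean (h s).1 else 0 with hZ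
  have mZ : Measurable Z := measurable_noise D S
  -- Chernoff's bound at the optimal parameters θ = ±r, one for each tail.
  have one : ∀ θ : ℝ, θ ^ 2 = r ^ 2 →
      (law ρ D t).real {h | b * r ^ 2 ≤ θ * Z h} ≤ Real.exp (-(b * r ^ 2 / 2)) := by
    intro θ hθ
    have h1 := lintegral_exp_noise_le ρ D S θ t
    have h2 := mul_meas_ge_le_lintegral (μ := law ρ D t)
      ((mZ.const_mul θ).exp).ennreal_ofReal (ENNReal.ofReal (Real.exp (b * r ^ 2)))
    have h3 : ENNReal.ofReal (Real.exp (θ ^ 2 / 2)) ^ (S.filter (· < t)).card ≤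
        ENNReal.ofReal (Real.exp (b * r ^ 2 / 2)) := by
      rw [← ENNReal.ofReal_pow (Real.exp_pos _).le, ← Real.exp_nat_mul, hθ]
      refine ENNReal.ofReal_le_ofReal (Real.exp_le_exp.2 ?_)
      have : ((S.filter (· < t)).card : ℝ) ≤ b := by
        exact_mod_cast (Finset.card_filter_le _ _).trans hS
      nlinarith [sq_nonneg r]
    have h4 := h2.trans (h1.trans h3)
    have hset : {h | ENNReal.ofReal (Real.exp (b * r ^ 2)) ≤ ENNReal.ofReal (Real.exp (θ * Z h))} =
        {h | b * r ^ 2 ≤ θ * Z h} := by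
      ext h
      simp [ENNReal.ofReal_le_ofReal_iff (Real.exp_pos _).le]
    rw [hset] at h4
    have h5 := ENNReal.toReal_mono ENNReal.ofReal_ne_top h4
    rw [ENNReal.toReal_mul, ENNReal.toReal_ofReal (Real.exp_pos _).le,
      ENNReal.toReal_ofReal (Real.exp_pos _).le] at h5
    have h6 : (law ρ D t).real {h | b * r ^ 2 ≤ θ * Z h} ≤
        Real.exp (b * r ^ 2 / 2) / Real.exp (b * r ^ 2) := by
      rw [le_div_iff₀ (Real.exp_pos _), mul_comm]
      exact h5
    rw [← Real.exp_sub] at h6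
    refine h6.trans (Real.exp_le_exp.2 (by linarith))
  calc (law ρ D t).real {h | b * r < |Z h|}
      ≤ (law ρ D t).real ({h | b * r ^ 2 ≤ r * Z h} ∪ {h | b * r ^ 2 ≤ (-r) * Z h}) := by
        refine measureReal_mono fun h hh => ?_
        rcases lt_abs.1 (show b * r < |Z h| from hh) with h1 | h1
        · left
          show b * r ^ 2 ≤ r * Z h
          nlinarith
        · right
          show b * r ^ 2 ≤ (-r) * Z h
          nlinarith
    _ ≤ _ := measureReal_union_le _ _
    _ ≤ _ := by
        have h1 := one r rfl
        have h2 := one (-r) (by ring)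
        linarith

/-! ### Policies that are deterministic functions of the rewards. -/

/-- The sequence of observed rewards, extended by `0`. -/
noncomputable def rewardSeq {k t : ℕ} (h : Hist k t) (s : ℕ) : ℝ :=
  if hs : s < t then (h ⟨s, hs⟩).2 else 0

theorem measurable_rewardSeq {k t : ℕ} : Measurable (rewardSeq : Hist k t → ℕ → ℝ) := by
  refine measurable_pi_lambda _ fun s => ?_
  unfold rewardSeq
  split_ifs
  · exact measurable_snd.comp (measurable_pi_apply _)
  · exact measurable_const

theorem rewardSeq_snoc {k t : ℕ} (h : Hist k t) (p : Fin k × ℝ) {s : ℕ} (hs : s < t) :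
    rewardSeq (Fin.snoc h p : Hist k (t + 1)) s = rewardSeq h s := by
  simp only [rewardSeq, hs, Nat.lt_succ_of_lt hs, dif_pos]
  congr 1
  exact Fin.snoc_castSucc (α := fun _ => Fin k × ℝ) p h ⟨s, hs⟩

/-- The policy that chooses actions by a deterministic function of the observed rewards. -/
noncomputable def detPolicy {k : ℕ} (F : ℕ → (ℕ → ℝ) → Fin k) (hF : ∀ t, Measurable (F t)) :
    Policy k where
  act t := Kernel.deterministic (fun h => F t (rewardSeq h)) ((hF t).comp measurable_rewardSeq)
  isMarkov _ := inferInstance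

/-- Almost surely a deterministic policy follows its rule. -/
theorem detPolicy_ae {k : ℕ} (F : ℕ → (ℕ → ℝ) → Fin k) (hF : ∀ t, Measurable (F t))
    (hloc : ∀ t x y, (∀ s < t, x s = y s) → F t x = F t y) (D : Env k) (T : ℕ) :
    ∀ᵐ h ∂(law (detPolicy F hF) D T), ∀ s : Fin T, (h s).1 = F s (rewardSeq h) := by
  have hms : ∀ t, MeasurableSet {h : Hist k t | ∀ s : Fin t, (h s).1 = F s (rewardSeq h)} := by
    intro t
    rw [Set.ofPred_forall]
    refine MeasurableSet.iInter fun s => ?_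
    exact measurableSet_eq_fun (measurable_action s) ((hF s).comp measurable_rewardSeq)
  induction T with
  | zero => exact Eventually.of_forall fun h s => s.elim0
  | succ t ih =>
    rw [ae_iff, ← Set.compl_ofPred, ← lintegral_indicator_one (hms _).compl,
      lintegral_law_succ _ _ _ (measurable_one.indicator (hms _).compl),
      lintegral_eq_zero_iff (measurable_lintegral_snoc _ _ _
        (measurable_one.indicator (hms _).compl))]
    filter_upwards [ih] with h hh
    have hgood : ∀ x, (Fin.snoc h (F t (rewardSeq h), x) : Hist k (t + 1)) ∉
        {h : Hist k (t + 1) | ∀ s : Fin (t + 1), (h s).1 = F s (rewardSeq h)}ᶜ := by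
      intro x
      rw [Set.notMem_compl_iff]
      intro s
      have hF' : ∀ s ≤ t, F s (rewardSeq (Fin.snoc h (F t (rewardSeq h), x) : Hist k (t + 1))) =
          F s (rewardSeq h) := fun s hs =>
        hloc s _ _ fun u hu => rewardSeq_snoc h _ (hu.trans_le hs)
      refine Fin.lastCases ?_ (fun s => ?_) s
      · simp [hF']
      · simpa [hF' s s.2.le] using hh s
    have : (detPolicy F hF).act t h = Measure.dirac (F t (rewardSeq h)) :=
      Kernel.deterministic_apply ((hF t).comp measurable_rewardSeq) h
    rw [this, lintegral_dirac]
    simp [Set.indicator_of_notMem (hgood _)]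

/-! ### Monotone substitutes; the grid of batches and slots. -/

/-- Choose the least element of `A` that is at least `i`, or the largest element of `A` if there is
none. -/
theorem exists_pick (k : ℕ) [NeZero k] : ∃ f : Set (Fin k) → Fin k → Fin k,
    ∀ A, A.Nonempty → Monotone (f A) ∧ (∀ i, f A i ∈ A) ∧ ∀ i ∈ A, f A i = i := by
  classical
  refine ⟨fun A i => if (A ∩ Set.Ici i).Nonempty then sInf (A ∩ Set.Ici i) else sSup A,
    fun A hA => ?_⟩
  have hinf : ∀ i, (A ∩ Set.Ici i).Nonempty → sInf (A ∩ Set.Ici i) ∈ A ∩ Set.Ici i :=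
    fun i hi => hi.csInf_mem (Set.toFinite _)
  have hsup : sSup A ∈ A := hA.csSup_mem (Set.toFinite _)
  refine ⟨fun i j hij => ?_, fun i => ?_, fun i hi => ?_⟩
  · by_cases hj : (A ∩ Set.Ici j).Nonempty
    · have hsub : A ∩ Set.Ici j ⊆ A ∩ Set.Ici i := fun u hu => ⟨hu.1, hij.trans hu.2⟩
      simp only [if_pos hj, if_pos (hj.mono hsub)]
      exact sInf_le_sInf hsub
    · simp only [if_neg hj]
      split_ifs with hi
      · exact le_sSup (hinf i hi).1
      · exact le_rfl
  · dsimp only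
    split_ifs with h
    · exact (hinf i h).1
    · exact hsup
  · have hne : (A ∩ Set.Ici i).Nonempty := ⟨i, hi, Set.mem_Ici.2 le_rfl⟩
    simp only [if_pos hne]
    exact le_antisymm (sInf_le ⟨hi, Set.mem_Ici.2 le_rfl⟩) (hinf i hne).2

/-- A choice of an element of `A` that is monotone in `i` and is `i` itself if `i ∈ A`. -/
noncomputable def pick {k : ℕ} [NeZero k] : Set (Fin k) → Fin k → Fin k :=
  (exists_pick k).choose

theorem pick_mono {k : ℕ} [NeZero k] {A : Set (Fin k)} (hA : A.Nonempty) : Monotone (pick A) :=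
  ((exists_pick k).choose_spec A hA).1

theorem pick_mem {k : ℕ} [NeZero k] {A : Set (Fin k)} (hA : A.Nonempty) (i : Fin k) :
    pick A i ∈ A :=
  ((exists_pick k).choose_spec A hA).2.1 i

theorem pick_eq {k : ℕ} [NeZero k] {A : Set (Fin k)} {i : Fin k} (hi : i ∈ A) : pick A i = i :=
  ((exists_pick k).choose_spec A ⟨i, hi⟩).2.2 i hi

/-- The first round of batch `m`, when batch `m` has `k` slots of `b m` rounds. -/
def start (k : ℕ) (b : ℕ → ℕ) : ℕ → ℕ
  | 0 => 0
  | m + 1 => start k b m + k * b m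

/-- The batch of round `t`. -/
def batch (k : ℕ) (b : ℕ → ℕ) (t : ℕ) : ℕ := Nat.findGreatest (fun m => start k b m ≤ t) t

/-- The slot of round `t` in its batch. -/
def slot (k : ℕ) [NeZero k] (b : ℕ → ℕ) (t : ℕ) : Fin k :=
  Fin.ofNat k ((t - start k b (batch k b t)) / b (batch k b t))

/-- The rounds of slot `i` of batch `m`. -/
def slotRounds {k : ℕ} (b : ℕ → ℕ) (m : ℕ) (i : Fin k) : Finset ℕ :=
  Finset.Ico (start k b m + i * b m) (start k b m + (i + 1) * b m)

section Grid

variable {k : ℕ} {b : ℕ → ℕ}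

theorem start_mono : Monotone (start k b) :=
  monotone_nat_of_le_succ fun _ => Nat.le_add_right _ _

theorem start_strictMono [NeZero k] (hb : ∀ m, 0 < b m) : StrictMono (start k b) :=
  strictMono_nat_of_lt_succ fun m =>
    Nat.lt_add_of_pos_right (Nat.mul_pos (Nat.pos_of_ne_zero (NeZero.ne k)) (hb m))

/-- The search bound `t` in `batch` is harmless, because m ≤ start m for a strictly increasing
`start`. -/
theorem batch_eq [NeZero k] (hb : ∀ m, 0 < b m) {m t : ℕ} (h1 : start k b m ≤ t)
    (h2 : t < start k b (m + 1)) : batch k b t = m := by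
  have hs := start_strictMono (k := k) hb
  have hle : m ≤ batch k b t := Nat.le_findGreatest ((hs.id_le m).trans h1) h1
  have hspec : start k b (batch k b t) ≤ t :=
    Nat.findGreatest_spec (P := fun m => start k b m ≤ t) ((hs.id_le m).trans h1) h1
  have := hs.lt_iff_lt.1 (hspec.trans_lt h2)
  omega

theorem start_batch_le (t : ℕ) : start k b (batch k b t) ≤ t :=
  Nat.findGreatest_spec (P := fun m => start k b m ≤ t) (Nat.zero_le t) (Nat.zero_le t)

theorem lt_start_batch_succ [NeZero k] (hb : ∀ m, 0 < b m) (t : ℕ) :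
    t < start k b (batch k b t + 1) := by
  by_contra! h
  have := Nat.le_findGreatest (P := fun m => start k b m ≤ t)
    (((start_strictMono (k := k) hb).id_le _).trans h) h
  change batch k b t + 1 ≤ batch k b t at this
  omega

/-- The reduction modulo `k` in `slot` never takes effect. -/
theorem slot_val [NeZero k] (hb : ∀ m, 0 < b m) (t : ℕ) :
    (slot k b t : ℕ) = (t - start k b (batch k b t)) / b (batch k b t) := by
  have h1 := lt_start_batch_succ (k := k) hb t
  have h2 : t - start k b (batch k b t) < k * b (batch k b t) := by
    rw [start] at h1
    have := start_batch_le (k := k) (b := b) t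
    omega
  exact Nat.mod_eq_of_lt ((Nat.div_lt_iff_lt_mul (hb _)).2 h2)

theorem slot_mono [NeZero k] (hb : ∀ m, 0 < b m) {s t : ℕ} (hst : s ≤ t)
    (h : batch k b s = batch k b t) : slot k b s ≤ slot k b t := by
  rw [Fin.le_def, slot_val hb, slot_val hb, h]
  exact Nat.div_le_div_right (by omega)

theorem slotRounds_bounds {m : ℕ} {i : Fin k} {s : ℕ} (hs : s ∈ slotRounds b m i) :
    start k b m ≤ s ∧ s < start k b (m + 1) := by
  rw [slotRounds, Finset.mem_Ico] at hs
  have : (i + 1) * b m ≤ k * b m := Nat.mul_le_mul_right _ i.2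
  rw [start]
  constructor <;> omega

theorem slot_eq [NeZero k] (hb : ∀ m, 0 < b m) {m : ℕ} {i : Fin k} {s : ℕ}
    (hs : s ∈ slotRounds b m i) : batch k b s = m ∧ slot k b s = i := by
  have h1 := slotRounds_bounds hs
  have hm := batch_eq hb h1.1 h1.2
  refine ⟨hm, Fin.ext ?_⟩
  rw [slot_val hb, hm]
  rw [slotRounds, Finset.mem_Ico] at hs
  refine Nat.div_eq_of_lt_le ?_ ?_ <;> omega

theorem slotRounds_card (m : ℕ) (i : Fin k) : (slotRounds b m i).card = b m := by
  rw [slotRounds, Nat.card_Ico, Nat.add_one_mul]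
  omega

theorem sum_batch_le [NeZero k] (hb : ∀ m, 0 < b m) {g : ℕ → ℝ} (hg : ∀ m, 0 ≤ g m) {T M : ℕ}
    (hM : T ≤ start k b M) :
    ∑ t : Fin T, g (batch k b t) ≤ ∑ m ∈ Finset.range M, k * b m * g m := by
  rw [Fin.sum_univ_eq_sum_range (fun t => g (batch k b t))]
  refine (Finset.sum_le_sum_of_subset_of_nonneg (Finset.range_mono hM)
    fun t _ _ => hg _).trans (le_of_eq ?_)
  clear hM
  induction M with
  | zero => simp [start]
  | succ M ih =>
    rw [Finset.sum_range_succ, ← ih, ← Finset.sum_range_add_sum_Ico _ (start_mono (Nat.le_succ M))]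
    congr 1
    rw [Finset.sum_congr rfl fun t ht => by
      rw [batch_eq hb (Finset.mem_Ico.1 ht).1 (Finset.mem_Ico.1 ht).2]]
    simp [start]

end Grid

/-! ### Batched successive elimination. -/

/-- The average reward observed in slot `i` of batch `m`. -/
noncomputable def slotMean {k : ℕ} (b : ℕ → ℕ) (x : ℕ → ℝ) (m : ℕ) (i : Fin k) : ℝ :=
  (∑ s ∈ slotRounds b m i, x s) / b m

/-- The actions that are still active in batch `m`. -/
def active (k : ℕ) (b : ℕ → ℕ) (r : ℕ → ℝ) (x : ℕ → ℝ) : ℕ → Set (Fin k)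
  | 0 => Set.univ
  | m + 1 => {i | i ∈ active k b r x m ∧
      ∀ j ∈ active k b r x m, slotMean b x m j ≤ slotMean b x m i + 2 * r m}

/-- Successive elimination in batches: slot `i` of a batch plays action `i` if it is active, and an
active action next to it otherwise. -/
noncomputable def eliminationRule (k : ℕ) [NeZero k] (b : ℕ → ℕ) (r : ℕ → ℝ) (t : ℕ)
    (x : ℕ → ℝ) : Fin k :=
  pick (active k b r x (batch k b t)) (slot k b t)

section Elimination

variable {k : ℕ} {b : ℕ → ℕ} {r : ℕ → ℝ}

theorem active_nonempty [NeZero k] (hr : ∀ m, 0 ≤ r m) (x : ℕ → ℝ) (m : ℕ) :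
    (active k b r x m).Nonempty := by
  induction m with
  | zero => exact Set.univ_nonempty
  | succ m ih =>
    obtain ⟨i, hi, hmax⟩ := Set.exists_max_image _ (slotMean b x m) (Set.toFinite _) ih
    exact ⟨i, hi, fun j hj => (hmax j hj).trans (by linarith [hr m])⟩

theorem slotMean_congr {x y : ℕ → ℝ} {m : ℕ} (h : ∀ s < start k b (m + 1), x s = y s)
    (i : Fin k) : slotMean b x m i = slotMean b y m i := by
  rw [slotMean, slotMean, Finset.sum_congr rfl fun s hs => h s (slotRounds_bounds hs).2]

theorem active_congr {x y : ℕ → ℝ} {m : ℕ} (h : ∀ s < start k b m, x s = y s) :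
    active k b r x m = active k b r y m := by
  induction m with
  | zero => rfl
  | succ m ih =>
    simp only [active, ih fun s hs => h s (hs.trans_le (start_mono (Nat.le_succ m))),
      slotMean_congr h]

theorem measurable_slotMean (m : ℕ) (i : Fin k) : Measurable fun x => slotMean b x m i :=
  (Finset.measurable_sum _ fun s _ => measurable_pi_apply s).div_const _

theorem measurable_active (m : ℕ) : Measurable fun x => active k b r x m := by
  induction m with
  | zero => exact measurable_const
  | succ m ih =>
    rw [measurable_set_iff] at ih ⊢
    intro i
    refine (ih i).and (Measurable.forall fun j => (ih j).imp ?_)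
    exact measurableSet_setOfPred.1 (measurableSet_le (measurable_slotMean m j)
      ((measurable_slotMean m i).add_const _))

variable [NeZero k]

theorem measurable_eliminationRule (t : ℕ) : Measurable (eliminationRule k b r t) :=
  (measurable_of_finite fun A : Set (Fin k) => pick A (slot k b t)).comp (measurable_active _)

theorem eliminationRule_congr (t : ℕ) (x y : ℕ → ℝ) (h : ∀ s < t, x s = y s) :
    eliminationRule k b r t x = eliminationRule k b r t y := by
  rw [eliminationRule, eliminationRule,
    active_congr fun s hs => h s (hs.trans_le (start_batch_le t))]

/-- Batched elimination re-switches each action at most once per batch. -/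
theorem reswitches_le (hb : ∀ m, 0 < b m) (hr : ∀ m, 0 ≤ r m) {T M : ℕ} (hM : T ≤ start k b M)
    {h : Hist k T} (hh : ∀ s : Fin T, (h s).1 = eliminationRule k b r s (rewardSeq h))
    (j : Fin k) : reswitches h j ≤ M := by
  have hmono : ∀ s t : Fin T, s ≤ t → batch k b s = batch k b t → (h s).1 ≤ (h t).1 := by
    intro s t hst hbt
    rw [hh, hh, eliminationRule, eliminationRule, hbt]
    exact pick_mono (active_nonempty hr _ _) (slot_mono hb hst hbt)
  have key : ∀ u v : Fin T, (h u).1 = j → ((h v).1 = j ∧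
      ∀ s : Fin T, (s : ℕ) + 1 = v → (h s).1 ≠ j) → batch k b u = batch k b v → ¬ u < v := by
    intro u v hu hv huv hlt
    rw [Fin.lt_def] at hlt
    -- The round before `v` lies in the same batch, so monotonicity squeezes its action between two
    -- copies of `j`; then `v` is no re-switch.
    set w : Fin T := ⟨v - 1, by omega⟩ with hw
    have hwv : batch k b w = batch k b v := by
      refine batch_eq hb ?_ ?_
      · rw [← huv]
        exact (start_batch_le (u : ℕ)).trans (by simp only [hw]; omega)
      · exact lt_of_le_of_lt (by simp only [hw]; omega) (lt_start_batch_succ hb (v : ℕ))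
    have h1 := hmono u w (by rw [Fin.le_def]; simp only [hw]; omega) (huv.trans hwv.symm)
    have h2 := hmono w v (by rw [Fin.le_def]; simp only [hw]; omega) hwv
    rw [hu] at h1
    rw [hv.1] at h2
    exact hv.2 w (by simp only [hw]; omega) (le_antisymm h2 h1)
  rw [← Finset.card_range M]
  refine Finset.card_le_card_of_injOn (fun t : Fin T => batch k b t) (fun t _ => ?_) ?_
  · have : start k b (batch k b t) < start k b M := (start_batch_le _).trans_lt (t.2.trans_le hM)
    simpa using (start_strictMono hb).lt_iff_lt.1 this
  · intro u hu v hv huv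
    simp only [Finset.coe_filter, Finset.mem_univ, true_and] at hu hv
    rcases lt_trichotomy u v with h1 | h1 | h1
    · exact absurd h1 (key u v hu.1 hv huv)
    · exact h1
    · exact absurd h1 (key v u hv.1 hu huv.symm)

/-- The bound on the gaps of the actions that are active in batch `m`. -/
def gapBound (r : ℕ → ℝ) : ℕ → ℝ
  | 0 => 1
  | m + 1 => 4 * r m

theorem gapBound_nonneg (hr : ∀ m, 0 ≤ r m) (m : ℕ) : 0 ≤ gapBound r m := by
  cases m with
  | zero => exact zero_le_one
  | succ m => exact mul_nonneg (by norm_num) (hr m)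

/-- If all estimates err by at most r, a best action is never eliminated, and a survivor trails by
2r in estimate, hence by 4r in mean. As batch `m` starts before `T`, earlier batches are complete
and the default value of `rewardSeq` never enters the averages used. -/
theorem active_gap_le (D : Env k) (hb : ∀ m, 0 < b m) {T M : ℕ}
    (hM : T ≤ start k b M) {h : Hist k T}
    (hh : ∀ s : Fin T, (h s).1 = eliminationRule k b r s (rewardSeq h))
    (hgood : ∀ m < M, ∀ i : Fin k, |∑ s : Fin T,
      if (s : ℕ) ∈ slotRounds b m i then (h s).2 - D.mean (h s).1 else 0| ≤ b m * r m)
    {i₀ : Fin k} (hi₀ : D.mean i₀ = D.best) (m : ℕ) (hm : start k b m < T) :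
    i₀ ∈ active k b r (rewardSeq h) m ∧
      ∀ i ∈ active k b r (rewardSeq h) m, D.best - D.mean i ≤ gapBound r m := by
  induction m with
  | zero => exact ⟨Set.mem_univ _, fun i _ => D.best_sub_mean_le_one i⟩
  | succ m ih =>
    obtain ⟨ih1, -⟩ := ih ((start_mono (Nat.le_succ m)).trans_lt hm)
    have hmM : m < M :=
      (Nat.lt_succ_self m).trans ((start_strictMono hb).lt_iff_lt.1 (hm.trans_le hM))
    have hest : ∀ i ∈ active k b r (rewardSeq h) m,
        |slotMean b (rewardSeq h) m i - D.mean i| ≤ r m := by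
      intro i hi
      have hb0 : (0 : ℝ) < b m := by exact_mod_cast hb m
      have hsum : ∑ s : Fin T,
          (if (s : ℕ) ∈ slotRounds b m i then (h s).2 - D.mean (h s).1 else 0) =
          ∑ s ∈ slotRounds b m i, (rewardSeq h s - D.mean i) := by
        have h1 : ∀ s : Fin T,
            (if (s : ℕ) ∈ slotRounds b m i then (h s).2 - D.mean (h s).1 else 0) =
            if (s : ℕ) ∈ slotRounds b m i then rewardSeq h s - D.mean i else 0 := by
          intro s
          split_ifs with hs
          · have h2 := slot_eq hb hs
            rw [hh s, eliminationRule, h2.1, h2.2, pick_eq hi]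
            simp [rewardSeq]
          · rfl
        rw [Finset.sum_congr rfl fun s _ => h1 s, Fin.sum_univ_eq_sum_range
          (fun s => if s ∈ slotRounds b m i then rewardSeq h s - D.mean i else 0),
          ← Finset.sum_filter]
        congr 1
        ext s
        simp only [Finset.mem_filter, Finset.mem_range, and_iff_right_iff_imp]
        exact fun hs => (slotRounds_bounds hs).2.trans hm
      have hg := hgood m hmM i
      rw [hsum, Finset.sum_sub_distrib, Finset.sum_const, slotRounds_card, nsmul_eq_mul] at hg
      have e : ∑ s ∈ slotRounds b m i, rewardSeq h s - b m * D.mean i =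
          b m * (slotMean b (rewardSeq h) m i - D.mean i) := by
        rw [slotMean]
        field_simp
      rw [e, abs_mul, abs_of_pos hb0] at hg
      exact le_of_mul_le_mul_left hg hb0
    have h0 := abs_le.1 (hest i₀ ih1)
    refine ⟨⟨ih1, fun j hj => ?_⟩, fun i hi => ?_⟩
    · have := abs_le.1 (hest j hj)
      have := D.mean_le_best j
      linarith
    · have h1 := abs_le.1 (hest i hi.1)
      have h2 := hi.2 i₀ ih1
      simp only [gapBound]
      linarith

/-- The batched elimination policy. -/
noncomputable def elimination (k : ℕ) [NeZero k] (b : ℕ → ℕ) (r : ℕ → ℝ) : Policy k :=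
  detPolicy (eliminationRule k b r) measurable_eliminationRule

theorem elimination_ae (D : Env k) (T : ℕ) : ∀ᵐ h ∂(law (elimination k b r) D T),
    ∀ s : Fin T, (h s).1 = eliminationRule k b r s (rewardSeq h) :=
  detPolicy_ae _ _ eliminationRule_congr D T

/-- Off the bad event each batch costs its length times `gapBound`; on it the regret is at most `T`,
since gaps are at most 1. -/
theorem regretIn_elimination_le (D : Env k) (hb : ∀ m, 0 < b m) (hr : ∀ m, 0 ≤ r m) {T M : ℕ}
    (hM : T ≤ start k b M) :
    regretIn (elimination k b r) D T ≤ ∑ m ∈ Finset.range M, k * b m * gapBound r m +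
      T * ∑ m ∈ Finset.range M, k * (2 * Real.exp (-(b m * r m ^ 2 / 2))) := by
  set μ := law (elimination k b r) D T with hμ
  set bad : ℕ → Fin k → Set (Hist k T) := fun m i => {h | b m * r m < |∑ s : Fin T,
    if (s : ℕ) ∈ slotRounds b m i then (h s).2 - D.mean (h s).1 else 0|} with hbad
  set U : Set (Hist k T) := ⋃ p ∈ Finset.range M ×ˢ (Finset.univ : Finset (Fin k)), bad p.1 p.2
    with hU
  have mU : MeasurableSet U := by
    refine Finset.measurableSet_biUnion _ fun p _ => ?_
    exact measurableSet_lt measurable_const (measurable_noise D _).abs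
  have hUle : μ.real U ≤ ∑ m ∈ Finset.range M, k * (2 * Real.exp (-(b m * r m ^ 2 / 2))) := by
    refine (measureReal_biUnion_finset_le _ _).trans ?_
    rw [Finset.sum_product]
    refine Finset.sum_le_sum fun m _ => ?_
    refine (Finset.sum_le_sum fun i _ => noise_tail (elimination k b r) D (slotRounds b m i)
      (slotRounds_card m i).le (hr m) T).trans (le_of_eq ?_)
    simp
  obtain ⟨i₀, hi₀⟩ := exists_eq_ciSup_of_finite (f := D.mean)
  have hpt : ∀ᵐ h ∂μ, ∑ t, (D.best - D.mean (h t).1) ≤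
      ∑ m ∈ Finset.range M, k * b m * gapBound r m + U.indicator (fun _ => (T : ℝ)) h := by
    filter_upwards [elimination_ae D T] with h hh
    have hK : (0 : ℝ) ≤ ∑ m ∈ Finset.range M, k * b m * gapBound r m :=
      Finset.sum_nonneg fun m _ => mul_nonneg (by positivity) (gapBound_nonneg hr m)
    by_cases hhU : h ∈ U
    · rw [Set.indicator_of_mem hhU]
      have : ∑ t, (D.best - D.mean (h t).1) ≤ ∑ t : Fin T, (1 : ℝ) :=
        Finset.sum_le_sum fun t _ => D.best_sub_mean_le_one _
      simp only [Finset.sum_const, Finset.card_univ, Fintype.card_fin, nsmul_eq_mul,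
        mul_one] at this
      linarith
    · rw [Set.indicator_of_notMem hhU, add_zero]
      have hgood : ∀ m < M, ∀ i : Fin k, |∑ s : Fin T,
          if (s : ℕ) ∈ slotRounds b m i then (h s).2 - D.mean (h s).1 else 0| ≤ b m * r m := by
        intro m hm i
        by_contra! hcon
        refine hhU (Set.mem_iUnion₂.2 ⟨(m, i), ?_, hcon⟩)
        simpa using hm
      refine le_trans (Finset.sum_le_sum fun t _ => ?_)
        (sum_batch_le hb (gapBound_nonneg hr) hM)
      refine (active_gap_le D hb hM hh hgood hi₀ (batch k b t)
        ((start_batch_le (t : ℕ)).trans_lt t.2)).2 _ ?_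
      rw [hh t]
      exact pick_mem (active_nonempty hr _ _) _
  have hind : Integrable (U.indicator fun _ => (T : ℝ)) μ := (integrable_const _).indicator mU
  rw [regretIn_eq]
  refine (integral_mono_ae (integrable_finsetSum _ fun t _ => (integrable_const _).sub
    (integrable_action _ D _ t)) ((integrable_const _).add hind) hpt).trans ?_
  rw [integral_add' (integrable_const _) hind, integral_indicator_const _ mU, integral_const]
  simp only [probReal_univ, one_mul, smul_eq_mul]
  rw [mul_comm (μ.real U)]
  gcongr

end Elimination

/-! ### Choice of slot lengths and radii. -/

/-- The length of the slots of batch `m` for horizon `T`. -/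
noncomputable def slotLength (T m : ℕ) : ℕ := ⌈(T : ℝ) ^ (1 - (1 / 2 : ℝ) ^ (m + 1))⌉₊

/-- The confidence radius of batch `m` for horizon `T`. -/
noncomputable def radius (T m : ℕ) : ℝ := √(2 * Real.log T / slotLength T m)

theorem slotLength_pos {T : ℕ} (hT : 1 ≤ T) (m : ℕ) : 0 < slotLength T m := by
  have : (0 : ℝ) < T := by exact_mod_cast hT
  exact Nat.ceil_pos.2 (by positivity)

theorem slotLength_le {T : ℕ} (hT : 1 ≤ T) (m : ℕ) :
    (slotLength T m : ℝ) ≤ 2 * (T : ℝ) ^ (1 - (1 / 2 : ℝ) ^ (m + 1)) := by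
  have h1 : (1 : ℝ) ≤ (T : ℝ) ^ (1 - (1 / 2 : ℝ) ^ (m + 1)) :=
    Real.one_le_rpow (by exact_mod_cast hT)
      (sub_nonneg.2 (pow_le_one₀ (by norm_num) (by norm_num)))
  have := Nat.ceil_lt_add_one (zero_le_one.trans h1)
  rw [slotLength]
  linarith

/-- The last batch alone suffices: its slots have length at least T/2, and there are at least two.
-/
theorem le_start_slotLength {k T M : ℕ} (hk : 2 ≤ k) (hT : 1 ≤ T) (hM : 1 ≤ M)
    (h : 2 * Real.log T ≤ 2 ^ M) : T ≤ start k (slotLength T) M := by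
  obtain ⟨M, rfl⟩ : ∃ M', M = M' + 1 := ⟨M - 1, by omega⟩
  have hT0 : (0 : ℝ) < T := by exact_mod_cast hT
  have h2 : (T : ℝ) ^ ((1 / 2 : ℝ) ^ (M + 1)) ≤ 2 := by
    rw [Real.rpow_def_of_pos hT0, ← Real.le_log_iff_exp_le (by norm_num)]
    have : Real.log T * (1 / 2) ^ (M + 1) ≤ 1 / 2 := by
      rw [one_div, inv_pow, ← div_eq_mul_inv, div_le_iff₀ (by positivity)]
      linarith
    linarith [Real.log_two_gt_d9]
  have h3 : (T : ℝ) ≤ k * slotLength T M := by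
    calc (T : ℝ) = (T : ℝ) ^ ((1 / 2 : ℝ) ^ (M + 1)) * (T : ℝ) ^ (1 - (1 / 2 : ℝ) ^ (M + 1)) := by
          rw [← Real.rpow_add hT0]
          simp
      _ ≤ 2 * slotLength T M := by
          gcongr
          exact Nat.le_ceil _
      _ ≤ k * slotLength T M := by
          gcongr
          exact_mod_cast hk
  have h4 : T ≤ k * slotLength T M := by exact_mod_cast h3
  rw [start]
  omega

/-- The lengths are chosen so that b_{m+1}/√b_m is of order √T; batch 0, with gaps up to 1, has
slots of length about √T. -/
theorem slotLength_mul_gapBound_le {T : ℕ} (hT : 1 ≤ T) (hlog : 1 ≤ Real.log T) (m : ℕ) :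
    slotLength T m * gapBound (radius T) m ≤ 16 * Real.log T * (T : ℝ) ^ (1 / 2 : ℝ) := by
  have hT0 : (0 : ℝ) < T := by exact_mod_cast hT
  have hpos : 0 < (T : ℝ) ^ (1 / 2 : ℝ) := by positivity
  rcases m with _ | m
  · have := slotLength_le hT 0
    norm_num at this
    norm_num [gapBound]
    nlinarith
  · have h1 := slotLength_le hT (m + 1)
    have hle : radius T m ≤
        2 * Real.log T * (T : ℝ) ^ (-((1 - (1 / 2 : ℝ) ^ (m + 1)) / 2)) := by
      rw [radius]
      refine Real.sqrt_le_iff.2 ⟨by positivity, ?_⟩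
      have h2 : (T : ℝ) ^ (1 - (1 / 2 : ℝ) ^ (m + 1)) ≤ slotLength T m := Nat.le_ceil _
      have h3 : ((T : ℝ) ^ (-((1 - (1 / 2 : ℝ) ^ (m + 1)) / 2))) ^ 2 =
          ((T : ℝ) ^ (1 - (1 / 2 : ℝ) ^ (m + 1)))⁻¹ := by
        rw [← Real.rpow_natCast, ← Real.rpow_mul hT0.le, ← Real.rpow_neg hT0.le]
        congr 1
        push_cast
        ring
      rw [mul_pow, h3, ← div_eq_mul_inv]
      gcongr
      nlinarith
    have hrad : 0 ≤ radius T m := Real.sqrt_nonneg _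
    calc slotLength T (m + 1) * gapBound (radius T) (m + 1)
        ≤ 2 * (T : ℝ) ^ (1 - (1 / 2 : ℝ) ^ (m + 1 + 1)) *
          (4 * (2 * Real.log T * (T : ℝ) ^ (-((1 - (1 / 2 : ℝ) ^ (m + 1)) / 2)))) := by
          rw [gapBound]
          gcongr
      _ = 16 * Real.log T * ((T : ℝ) ^ (1 - (1 / 2 : ℝ) ^ (m + 1 + 1)) *
          (T : ℝ) ^ (-((1 - (1 / 2 : ℝ) ^ (m + 1)) / 2))) := by ring
      _ = _ := by
          rw [← Real.rpow_add hT0]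
          congr 2
          rw [pow_succ _ (m + 1)]
          ring

theorem exists_loglog_policy {k : ℕ} (hk : 2 ≤ k) : ∃ π : ℕ → Policy k,
    AchievesRegret π (1 / 2) ∧ Within π (fun T => 5 * Real.log (Real.log T)) := by
  have : NeZero k := ⟨by omega⟩
  -- As 4 log 2 ≥ 2, this gives 2^M ≥ (log T)² ≥ 2 log T; the 5 in the statement absorbs the
  -- ceiling.
  set M : ℕ → ℕ := fun T => ⌈4 * Real.log (Real.log T)⌉₊
  have hr : ∀ T m, 0 ≤ radius T m := fun T m => Real.sqrt_nonneg _
  have hev : ∀ᶠ T : ℕ in atTop, 1 ≤ T ∧ 2 ≤ Real.log T ∧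
      (M T : ℝ) ≤ 5 * Real.log (Real.log T) ∧ T ≤ start k (slotLength T) (M T) := by
    filter_upwards [eventually_ge_atTop 1, tendsto_log_natCast.eventually_ge_atTop 2,
      tendsto_loglog_natCast.eventually_ge_atTop 1] with T hT hL hl
    have hceil : (M T : ℝ) < 4 * Real.log (Real.log T) + 1 := Nat.ceil_lt_add_one (by linarith)
    refine ⟨hT, hL, by linarith, le_start_slotLength hk hT (Nat.ceil_pos.2 (by linarith)) ?_⟩
    have hle : 4 * Real.log (Real.log T) ≤ M T := Nat.le_ceil _
    calc 2 * Real.log T ≤ Real.log T ^ 2 := by nlinarith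
      _ = Real.exp (2 * Real.log (Real.log T)) := by
          rw [← Real.exp_log (show 0 < Real.log T by linarith), ← Real.exp_nat_mul]
          simp
      _ ≤ Real.exp (M T * Real.log 2) := by
          refine Real.exp_le_exp.2 ?_
          nlinarith [Real.log_two_gt_d9]
      _ = 2 ^ M T := by rw [Real.exp_nat_mul, Real.exp_log (by norm_num)]
  refine ⟨fun T => elimination k (slotLength T) (radius T), ⟨90 * k, 2, ?_⟩, ?_⟩
  · filter_upwards [hev] with T ⟨hT, hL, hMl, hM⟩
    refine iSup_le fun D => EReal.coe_le_coe_iff.2 ?_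
    refine (regretIn_elimination_le D (slotLength_pos hT) (hr T) hM).trans ?_
    have hT0 : (0 : ℝ) < T := by exact_mod_cast hT
    have hsqrt : 1 ≤ (T : ℝ) ^ (1 / 2 : ℝ) :=
      Real.one_le_rpow (by exact_mod_cast hT) (by norm_num)
    -- The radius makes each tail 2/T, so the bad event contributes only 2kM to the regret.
    have hexp : ∀ m, Real.exp (-(slotLength T m * radius T m ^ 2 / 2)) = (T : ℝ)⁻¹ := by
      intro m
      have hb : (0 : ℝ) < slotLength T m := by exact_mod_cast slotLength_pos hT m
      rw [radius, Real.sq_sqrt (by positivity), mul_div_cancel₀ _ hb.ne',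
        mul_div_cancel_left₀ _ two_ne_zero, Real.exp_neg, Real.exp_log hT0]
    have h1 : ∑ m ∈ Finset.range (M T), k * slotLength T m * gapBound (radius T) m ≤
        M T * (k * (16 * Real.log T * (T : ℝ) ^ (1 / 2 : ℝ))) := by
      refine (Finset.sum_le_sum fun m _ => ?_).trans (le_of_eq (by
        rw [Finset.sum_const, Finset.card_range, nsmul_eq_mul]))
      rw [mul_assoc]
      refine mul_le_mul_of_nonneg_left ?_ (Nat.cast_nonneg k)
      exact slotLength_mul_gapBound_le hT (by linarith) m
    have h2 : T * ∑ m ∈ Finset.range (M T),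
        k * (2 * Real.exp (-(slotLength T m * radius T m ^ 2 / 2))) = M T * (k * 2) := by
      simp only [hexp, Finset.sum_const, Finset.card_range, nsmul_eq_mul]
      field_simp
    have h3 : (M T : ℝ) ≤ 5 * Real.log T := by
      have := Real.log_le_sub_one_of_pos (show 0 < Real.log T by linarith)
      linarith
    have h4 : (2 : ℝ) ≤ 2 * Real.log T * (T : ℝ) ^ (1 / 2 : ℝ) := by nlinarith
    calc _ ≤ M T * (k * (16 * Real.log T * (T : ℝ) ^ (1 / 2 : ℝ))) + M T * (k * 2) :=
          add_le_add h1 h2.le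
      _ ≤ M T * (k * (16 * Real.log T * (T : ℝ) ^ (1 / 2 : ℝ))) +
          M T * (k * (2 * Real.log T * (T : ℝ) ^ (1 / 2 : ℝ))) := by gcongr
      _ = M T * (k * (18 * Real.log T * (T : ℝ) ^ (1 / 2 : ℝ))) := by ring
      _ ≤ 5 * Real.log T * (k * (18 * Real.log T * (T : ℝ) ^ (1 / 2 : ℝ))) := by
          gcongr
      _ = _ := by ring
  · filter_upwards [hev] with T ⟨hT, _, hMl, hM⟩ D
    filter_upwards [elimination_ae D T] with h hh j
    exact (Nat.cast_le.2 (reswitches_le (slotLength_pos hT) (hr T) hM hh j)).trans hMl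

end Bandit

theorem proposition1 :
    (∀ (k : ℕ), 2 ≤ k → ∀ (N : ℕ), 1 ≤ N → ∀ π : ℕ → Bandit.Policy k,
      Bandit.AchievesRegret π (1 / (2 - (2 : ℝ) ^ (-(N : ℤ)))) →
        Bandit.Needs π (fun _ => (⌈(N : ℝ) / 2⌉ : ℝ))) ∧
    (∃ c₁ c₂ : ℝ, 0 < c₁ ∧ 0 < c₂ ∧ ∀ (k : ℕ), 2 ≤ k →
      (∀ π : ℕ → Bandit.Policy k, Bandit.AchievesRegret π (1 / 2) →
        Bandit.Needs π (fun T => c₁ * Real.log (Real.log T))) ∧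
      (∃ π : ℕ → Bandit.Policy k, Bandit.AchievesRegret π (1 / 2) ∧
        Bandit.Within π (fun T => c₂ * Real.log (Real.log T)))) :=
  ⟨fun _ hk _ hN _ hπ => Bandit.needs_ceil_half hk hN hπ,
    1 / 4, 5, by norm_num, by norm_num, fun _ hk =>
      ⟨fun _ hπ => Bandit.needs_loglog hk hπ, Bandit.exists_loglog_policy hk⟩⟩
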